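/- **Setting.** Let $G=(V,E)$ be a finite simple undirected graph. Write $\sigma_{st}$ for the number of shortest $s$–$t$ paths, $\sigma_{st}(v)$ for the number of those that pass through $v$, and $$\mathrm{bc}[v]=\sum_{s\ne v\ne t}\frac{\sigma_{st}(v)}{\sigma_{st}}$$ for the betweenness centrality of $v$ (sum over ordered pairs; pairs with $\sigma_{st}=0$ contribute $0$). This is also the score computed by Brandes' algorithm Bc-Org: for each source $s$, run a BFS from $s$ that computes distances, the path counts $\sigma$, the predecessor lists $P$ and a stack $S$ of the visited vertices; set $\delta\leftarrow 0$; pop the vertices $w$ from $S$, each time doing $\delta[v]\leftarrow\delta[v]+\frac{\sigma[v]}{\sigma[w]}(1+\delta[w])$ for all $v\in P[w]$ and, if $w\ne s$, $\mathrm{bc}[w]\leftarrow \mathrm{bc}[w]+\delta[w]$. *Bc-Reach.* For a graph with a weight $\mathrm{reach}$ on its vertices, Bc-Reach is Bc-Org with the initialisation $\delta[v]\leftarrow \mathrm{reach}(v)-1$ and the update $\mathrm{bc}'[w]\leftarrow \mathrm{bc}'[w]+\mathrm{reach}(s)\,\delta[w]$ for $w\neq s$. *Bfs-Side* from $s$ is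 the pass of Bc-Reach for the single source $s$, with the update $$\mathrm{bc}'[w]\leftarrow \mathrm{bc}'[w]+\mathrm{reach}(s)\,\delta[w]+\mathrm{reach}(s)\bigl(\delta[w]-(\mathrm{reach}(w)-1)\bigr)\qquad (w\ne s).$$ *Preprocessing.* Start with one copy of every vertex of $G$, the edges of $G$, $\mathrm{reach}\equiv1$ and $\mathrm{bc}'\equiv0$; $\mathrm{org}(v')\in V$ is the original of a copy $v'$. Perform finitely many operations of the following kinds, in any order. Each acts on a connected component $C$ of the current graph; all values of $\mathrm{reach}$ on the right are those before the operation. 1. *Articulation vertex* $u'\in C$ (its removal increases the number of components): remove $u'$; to each component $C_i$ of $C-u'$ add a new local copy $u'_i$ with $\mathrm{org}(u'_i)=\mathrm{org}(u')$, joined to the neighbours of $u'$ in $C_i$, with $\mathrm{reach}(u'_i)=\sum_{w\in C\setminus C_i}\mathrm{reach}(w)$ (the sum includes $w=u'$). 2. *Bridge* $\{u',v'\}$: remove this edge. Let $C_u\ni u'$ and $C_v\ni v'$ be the components formed and $R_u,R_v$ the sums of $\mathrm{reach}$ over them. Add $R_v$ to $\mathrm{reach}(u')$, $R_u$ to $\mathrm{reach}(v')$,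 $(R_u-1)R_v$ to $\mathrm{bc}'[u']$ and $(R_v-1)R_u$ to $\mathrm{bc}'[v']$. 3. *Degree-1 vertex* $u'$ with neighbour $v'$: remove $u'$. With $R=\sum_{w\in C\setminus\{u'\}}\mathrm{reach}(w)$, add $\mathrm{reach}(u')$ to $\mathrm{reach}(v')$, $(\mathrm{reach}(u')-1)R$ to $\mathrm{bc}'[u']$ and $(R-1)\,\mathrm{reach}(u')$ to $\mathrm{bc}'[v']$. 4. *Side vertex* $u'$ (its neighbours are pairwise adjacent): run Bfs-Side from $u'$ in the current graph, updating $\mathrm{bc}'$; then add $(\mathrm{reach}(u')-1)\sum_{w\in C\setminus\{u'\}}\mathrm{reach}(w)$ to $\mathrm{bc}'[u']$ and remove $u'$. **Corollary (compression with side vertices).** Let $G'$ be the graph after any such preprocessing (it need not be maximal). For a copy $v'$ let $\mathrm{bc}'[v']$ be the total of the amounts added to this entry during the preprocessing and of the amount computed by Bc-Reach on $G'$ with the final $\mathrm{reach}$. Then for every $v\in V$ $$\mathrm{bc}[v]=\sum_{v':\ \mathrm{org}(v')=v}\mathrm{bc}'[v'],$$ where $v'$ runs over all copies of $v$ that were present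 at any time, including those removed or replaced. This holds for every order in which the algorithms list the vertices and the neighbours of a vertex. -/

import Mathlib

namespace BC

/-! ### Betweenness centrality -/

section Betweenness

variable {α : Type*} (G : SimpleGraph α)

/-- The number `σ_st` of shortest paths from `s` to `t`
(walks from `s` to `t` whose length is the distance; there are none if `t` is unreachable). -/
noncomputable def numShortest (s t : α) : ℕ :=
  Nat.card {p : G.Walk s t // p.length = G.dist s t}

/-- The number `σ_st(v)` of shortest paths from `s` to `t` that pass through `v`. -/
noncomputable def numShortestThrough (s t v : α) : ℕ :=
  Nat.card {p : G.Walk s t // p.length = G.dist s t ∧ v ∈ p.support}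

/-- The pair dependency `δ_st(v) = σ_st(v) / σ_st` (it is `0` if `t` is unreachable from `s`). -/
noncomputable def pairDependency (s t v : α) : ℚ :=
  (numShortestThrough G s t v : ℚ) / (numShortest G s t : ℚ)

/-- The betweenness centrality of `v`: the sum of `δ_st(v)` over all ordered pairs `s ≠ v ≠ t`. -/
noncomputable def betweenness [Fintype α] [DecidableEq α] (v : α) : ℚ :=
  ∑ s ∈ Finset.univ.erase v, ∑ t ∈ Finset.univ.erase v, pairDependency G s t v

end Betweenness

/-! ### The algorithms Bc-Org, Bc-Reach and Bfs-Side -/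

/-- A representation of the graph with vertex set `verts` and edges `G` as the input of an
algorithm: the vertices, and the neighbours of each vertex, are listed in some order. -/
structure Listing {α : Type*} (verts : Finset α) (G : SimpleGraph α) where
  order : List α
  order_nodup : order.Nodup
  mem_order : ∀ v, v ∈ order ↔ v ∈ verts
  nbr : α → List α
  nbr_nodup : ∀ v, (nbr v).Nodup
  mem_nbr : ∀ v w, w ∈ nbr v ↔ G.Adj v w

open Classical in
theorem Listing.nonempty {α : Type*} {verts : Finset α} {G : SimpleGraph α}
    (h : ∀ {x y}, G.Adj x y → x ∈ verts) : Nonempty (Listing verts G) :=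
  ⟨{ order := verts.toList
     order_nodup := verts.nodup_toList
     mem_order := fun _ => Finset.mem_toList
     nbr := fun v => (verts.filter (G.Adj v)).toList
     nbr_nodup := fun _ => Finset.nodup_toList _
     mem_nbr := fun v w => by
       simp only [Finset.mem_toList, Finset.mem_filter, and_iff_right_iff_imp]
       exact fun hvw => h hvw.symm }⟩

section Algorithms

variable {α : Type*} [DecidableEq α]

/-- The variables of the breadth first search: queue `Q` (popped at the head, pushed at the end),
stack `S` (top at the head), predecessor lists `P`, path counts `σ`, distances `d`. -/
structure BfsState (α : Type*) where
  queue : List α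
  stack : List α
  pred : α → List α
  sigma : α → ℕ
  dist : α → ℤ

/-- The initialisation of the search from `s`. -/
def bfsStart (s : α) : BfsState α where
  queue := [s]
  stack := []
  pred := fun _ => []
  sigma := Function.update (fun _ => 0) s 1
  dist := Function.update (fun _ => -1) s 0

/-- `if d[w] < 0 then Q.push(w); d[w] ← d[v] + 1`. -/
def discover (v w : α) (st : BfsState α) : BfsState α :=
  if st.dist w < 0 then
    { st with
      queue := st.queue ++ [w]
      dist := Function.update st.dist w (st.dist v + 1) }
  else st

/-- `if d[w] = d[v] + 1 then σ[w] ← σ[w] + σ[v]; P[w].push(v)`. -/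
def countPaths (v w : α) (st : BfsState α) : BfsState α :=
  if st.dist w = st.dist v + 1 then
    { st with
      sigma := Function.update st.sigma w (st.sigma w + st.sigma v)
      pred := Function.update st.pred w (st.pred w ++ [v]) }
  else st

/-- One iteration of the loop `while Q is not empty`: pop `v` from `Q`, push it on `S` and treat
all neighbours of `v`. Nothing happens if the queue is empty. -/
def bfsStep (nbr : α → List α) (st : BfsState α) : BfsState α :=
  match st.queue with
  | [] => st
  | v :: q =>
    (nbr v).foldl (fun st w => countPaths v w (discover v w st))
      { st with queue := q, stack := v :: st.stack }

/-- Phase 1, the search from `s`. A vertex enters the queue at most once, so that the queue is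
empty after as many iterations as there are vertices. -/
def bfs {verts : Finset α} {G : SimpleGraph α} (L : Listing verts G) (s : α) : BfsState α :=
  (bfsStep L.nbr)^[L.order.length] (bfsStart s)

/-- `for v ∈ P[w] do δ[v] ← δ[v] + (σ[v] / σ[w]) * (1 + δ[w])`. -/
def accumulate (st : BfsState α) (w : α) (del : α → ℚ) : α → ℚ :=
  (st.pred w).foldl
    (fun del v =>
      Function.update del v (del v + (st.sigma v : ℚ) / (st.sigma w : ℚ) * (1 + del w)))
    del

/-- Phase 2, the back propagation for the source `s`, with initial values `del` for `δ`, on the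
array `bc`: vertices `w` are popped from the stack, the values of `δ` at the predecessors of `w`
are updated and, if `w ≠ s`, the number `contrib w δ[w]` is added to `bc[w]`. -/
def backPropagate (st : BfsState α) (s : α) (contrib : α → ℚ → ℚ) (del bc : α → ℚ) : α → ℚ :=
  (st.stack.foldl
    (fun (x : (α → ℚ) × (α → ℚ)) w =>
      let del' := accumulate st w x.1
      (del', if w ≠ s then Function.update x.2 w (x.2 w + contrib w (del' w)) else x.2))
    (del, bc)).2

/-- Algorithm Bc-Org (Brandes). -/
def bcOrg {verts : Finset α} {G : SimpleGraph α} (L : Listing verts G) : α → ℚ :=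
  L.order.foldl
    (fun bc s => backPropagate (bfs L s) s (fun _ d => d) (fun _ => 0) bc)
    (fun _ => 0)

/-- Algorithm Bc-Reach. -/
def bcReach {verts : Finset α} {G : SimpleGraph α} (L : Listing verts G) (reach : α → ℕ) :
    α → ℚ :=
  L.order.foldl
    (fun bc s =>
      backPropagate (bfs L s) s (fun _ d => (reach s : ℚ) * d) (fun v => (reach v : ℚ) - 1) bc)
    (fun _ => 0)

/-- Algorithm Bfs-Side for the side vertex `s`; it updates the array `bc`. -/
def bfsSide {verts : Finset α} {G : SimpleGraph α} (L : Listing verts G) (s : α)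
    (reach : α → ℕ) (bc : α → ℚ) : α → ℚ :=
  backPropagate (bfs L s) s
    (fun w d => (reach s : ℚ) * d + (reach s : ℚ) * (d - ((reach w : ℚ) - 1)))
    (fun v => (reach v : ℚ) - 1) bc

end Algorithms

/-! ### The preprocessing phase -/

/-- Copies of the vertices of `V`: `(v, i)` is the `i`-th copy of `v`. -/
abbrev Copy (V : Type*) := V × ℕ

/-- The map `org` sends a copy to its original. -/
def org {V : Type*} (x : Copy V) : V := x.1

/-- The data after some operations: the current graph with vertex set `verts` and edges `G`, the
array `reach`, the array `bc` of the compensations added so far, and the set `used` of all copies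
that have ever been present, including those removed or replaced since. -/
structure State (V : Type*) where
  verts : Finset (Copy V)
  G : SimpleGraph (Copy V)
  reach : Copy V → ℕ
  bc : Copy V → ℚ
  used : Finset (Copy V)
  mem_of_adj : ∀ {x y}, G.Adj x y → x ∈ verts
  verts_subset : verts ⊆ used

/-- The number of connected components of the graph with vertex set `W` induced by `G`. -/
noncomputable def numComponents {α : Type*} (G : SimpleGraph α) (W : Set α) : ℕ :=
  Nat.card (G.induce W).ConnectedComponent

namespace State

variable {V : Type*} [DecidableEq V]

/-- The initial data: one copy `(v, 0)` of each vertex, all with `reach` equal to `1`. -/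
def initial [Fintype V] (G : SimpleGraph V) : State V where
  verts := Finset.univ.image fun v => (v, 0)
  G := G.map (fun v => (v, 0))
  reach := fun _ => 1
  bc := fun _ => 0
  used := Finset.univ.image fun v => (v, 0)
  mem_of_adj := by
    intro x y h
    rw [SimpleGraph.map_adj'] at h
    obtain ⟨-, a, b, -, rfl, -⟩ := h
    simp
  verts_subset := subset_rfl

open Classical in
/-- The vertex set of the component of `u` in the graph with the edges `H`. -/
noncomputable def comp (g : State V) (H : SimpleGraph (Copy V)) (u : Copy V) : Finset (Copy V) :=
  g.verts.filter (fun x => H.Reachable u x)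

/-- The sum of `reach` over a set of vertices, as a rational number. -/
def reachSum (g : State V) (A : Finset (Copy V)) : ℚ := ∑ w ∈ A, (g.reach w : ℚ)

/-- `u` is an articulation vertex: its removal increases the number of components. -/
def IsArticulation (g : State V) (u : Copy V) : Prop :=
  u ∈ g.verts ∧
    numComponents g.G (g.verts : Set (Copy V)) < numComponents g.G (g.verts \ {u} : Set (Copy V))

/-- The edge `{u, v}` is a bridge. -/
def IsBridge (g : State V) (u v : Copy V) : Prop :=
  g.G.Adj u v ∧ g.G.IsBridge s(u, v)

/-- `u` is a degree-1 vertex, only connected to `v`. -/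
def IsDegreeOne (g : State V) (u v : Copy V) : Prop :=
  g.G.neighborSet u = {v}

/-- `u` is a side vertex: its neighbourhood is a clique. -/
def IsSide (g : State V) (u : Copy V) : Prop :=
  u ∈ g.verts ∧ g.G.IsClique (g.G.neighborSet u)

/-- The vertices other than `u` of the component of `u`. -/
noncomputable def around (g : State V) (u : Copy V) : Finset (Copy V) :=
  (g.comp g.G u).erase u

/-- An assignment of local copies for the shattering at `u`: for `x ≠ u` in the component `C` of
`u`, `κ x` is the local copy of `u` that is added to the component of `C - u` containing `x`. The
local copies are new copies of the original of `u`, one for each component of `C - u`. -/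
structure LocalCopies (g : State V) (u : Copy V) (κ : Copy V → Copy V) : Prop where
  org_eq : ∀ x ∈ g.around u, org (κ x) = org u
  fresh : ∀ x ∈ g.around u, κ x ∉ g.used
  eq_iff : ∀ x ∈ g.around u, ∀ y ∈ g.around u,
    κ x = κ y ↔ (g.G.deleteIncidenceSet u).Reachable x y

/-- Shattering at the articulation vertex `u`. The vertex `u` is replaced by the local copies
`κ x`. The local copy `y` is connected to the neighbours of `u` in its component `C_i`, and
`reach[y]` becomes the sum of `reach` over `C \ C_i`. -/
noncomputable def shatter (g : State V) (u : Copy V) (κ : Copy V → Copy V) : State V where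
  verts := g.verts.erase u ∪ (g.around u).image κ
  G := SimpleGraph.fromRel fun a b =>
    (g.G.deleteIncidenceSet u).Adj a b ∨ (g.G.Adj u b ∧ a = κ b)
  reach := fun y =>
    if y ∈ (g.around u).image κ then
      ∑ w ∈ g.comp g.G u \ (g.around u).filter (fun x => κ x = y), g.reach w
    else g.reach y
  bc := g.bc
  used := g.used ∪ (g.around u).image κ
  mem_of_adj := by
    have key : ∀ b, g.G.Adj u b → b ∈ g.around u := fun b h =>
      Finset.mem_erase.2 ⟨h.ne', by
        simpa [comp] using And.intro (g.mem_of_adj h.symm) h.reachable⟩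
    intro x y h
    rw [SimpleGraph.fromRel_adj] at h
    obtain ⟨-, (h | ⟨h, rfl⟩) | (h | ⟨h, -⟩)⟩ := h
    · rw [SimpleGraph.deleteIncidenceSet_adj] at h
      exact Finset.mem_union_left _ (Finset.mem_erase.2 ⟨h.2.1, g.mem_of_adj h.1⟩)
    · exact Finset.mem_union_right _ (Finset.mem_image_of_mem _ (key _ h))
    · rw [SimpleGraph.deleteIncidenceSet_adj] at h
      exact Finset.mem_union_left _ (Finset.mem_erase.2 ⟨h.2.2, g.mem_of_adj h.1.symm⟩)
    · exact Finset.mem_union_left _ (Finset.mem_erase.2 ⟨h.ne', g.mem_of_adj h.symm⟩)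
  verts_subset :=
    Finset.union_subset_union ((Finset.erase_subset _ _).trans g.verts_subset) subset_rfl

/-- The vertex set of the component of `u` after the removal of the edge `{u, v}`. -/
noncomputable def bridgeSide (g : State V) (u v : Copy V) : Finset (Copy V) :=
  g.comp (g.G.deleteEdges {s(u, v)}) u

/-- Removal of the bridge `{u, v}`. With `C_u` and `C_v` the components formed, the sums of
`reach` over `C_v` and `C_u` are added to `reach[u]` and `reach[v]`, and the missing dependencies
are added to `bc[u]` and `bc[v]`. -/
noncomputable def removeBridge (g : State V) (u v : Copy V) : State V where
  verts := g.verts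
  G := g.G.deleteEdges {s(u, v)}
  reach := fun x =>
    if x = u then g.reach u + ∑ w ∈ g.bridgeSide v u, g.reach w
    else if x = v then g.reach v + ∑ w ∈ g.bridgeSide u v, g.reach w
    else g.reach x
  bc := fun x =>
    if x = u then
      g.bc u + (g.reachSum (g.bridgeSide u v) - 1) * g.reachSum (g.bridgeSide v u)
    else if x = v then
      g.bc v + (g.reachSum (g.bridgeSide v u) - 1) * g.reachSum (g.bridgeSide u v)
    else g.bc x
  used := g.used
  mem_of_adj := fun h => g.mem_of_adj (SimpleGraph.deleteEdges_adj.1 h).1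
  verts_subset := g.verts_subset

/-- Removal of the degree-1 vertex `u` with neighbour `v`, in a component `C`: `reach[u]` is added
to `reach[v]`, and the missing dependencies are added to `bc[u]` and `bc[v]`. -/
noncomputable def removeDegreeOne (g : State V) (u v : Copy V) : State V where
  verts := g.verts.erase u
  G := g.G.deleteIncidenceSet u
  reach := fun x => if x = v then g.reach v + g.reach u else g.reach x
  bc := fun x =>
    if x = u then g.bc u + ((g.reach u : ℚ) - 1) * g.reachSum (g.around u)
    else if x = v then g.bc v + (g.reachSum (g.around u) - 1) * (g.reach u : ℚ)
    else g.bc x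
  used := g.used
  mem_of_adj := fun h =>
    have h' := SimpleGraph.deleteIncidenceSet_adj.1 h
    Finset.mem_erase.2 ⟨h'.2.1, g.mem_of_adj h'.1⟩
  verts_subset := (Finset.erase_subset _ _).trans g.verts_subset

/-- Removal of the side vertex `u`, in a component `C`: the array `bc` is updated by Bfs-Side, run
from `u` in the graph that still contains `u`, and `(reach[u] - 1)` times the sum of `reach` over
`C - u` is added to `bc[u]`. -/
noncomputable def removeSide (g : State V) (L : Listing g.verts g.G) (u : Copy V) : State V where
  verts := g.verts.erase u
  G := g.G.deleteIncidenceSet u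
  reach := g.reach
  bc := fun x =>
    if x = u then
      bfsSide L u g.reach g.bc u + ((g.reach u : ℚ) - 1) * g.reachSum (g.around u)
    else bfsSide L u g.reach g.bc x
  used := g.used
  mem_of_adj := fun h =>
    have h' := SimpleGraph.deleteIncidenceSet_adj.1 h
    Finset.mem_erase.2 ⟨h'.2.1, g.mem_of_adj h'.1⟩
  verts_subset := (Finset.erase_subset _ _).trans g.verts_subset

end State

/-- One shattering or compression operation of the preprocessing phase. -/
inductive Step {V : Type*} [DecidableEq V] : State V → State V → Prop
  | articulation (g : State V) (u : Copy V) (κ : Copy V → Copy V)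
      (hu : g.IsArticulation u) (hκ : g.LocalCopies u κ) : Step g (g.shatter u κ)
  | bridge (g : State V) (u v : Copy V) (h : g.IsBridge u v) : Step g (g.removeBridge u v)
  | degreeOne (g : State V) (u v : Copy V) (h : g.IsDegreeOne u v) :
      Step g (g.removeDegreeOne u v)
  | side (g : State V) (L : Listing g.verts g.G) (u : Copy V) (hu : g.IsSide u) :
      Step g (g.removeSide L u)

/-- `g` can be obtained from the graph `G` by finitely many operations, in any order. -/
def Preprocessed {V : Type*} [Fintype V] [DecidableEq V] (G : SimpleGraph V) (g : State V) :
    Prop :=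
  Relation.ReflTransGen Step (State.initial G) g

/-- The score `bc'[x]` of a copy: the compensations added during the preprocessing phase plus the
result of Bc-Reach on the final graph. -/
def finalScore {V : Type*} [DecidableEq V] (g : State V) (L : Listing g.verts g.G) (x : Copy V) :
    ℚ :=
  g.bc x + bcReach L g.reach x

end BC

/-! For weights r put D(s,v) = Σ_t r(t) δ_st(v), where the target t = v is included and counts with
δ_sv(v) = 1 (`dependency`). Let the score of x be the sum of r(s) (D(s,x) - 1) over the sources s ≠
x in the component of x (`score`). Brandes' recursion, in the form `dependency_eq_sum`, shows that
an array δ that starts at r - 1 ends at D(s,·) - 1. So Bc-Reach computes the score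
(`bcReach_eq_score`), and with all weights equal to 1 the score is both the output of Bc-Org and the
betweenness.

The theorem is then an invariant: for each original vertex, the sum over all copies ever used of
compensation plus current score (`State.total`) is unchanged by every operation (`Step.total_eq`).
At the start it is the betweenness, at the end the sum of the final scores.

Bridges, degree-1 vertices and articulation vertices rest on one principle. Let a component be split
into A and B, where A can be left only through its element u, a gate. Shortest paths from A to B
factor through u, so δ_st(v) = δ_su(v) for s, v in A and t in B (`IsGated.pairDependency_eq`). Hence
B may be cut off if its weight is added to u: the dependencies inside A do not change, the scores of
the vertices of A other than u do not change (`IsComponentIso.score_eq_of_ne`), and u loses exactly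
the contributions of the sources in B (`IsComponentIso.score_gate`). If B contains all shortest
paths between its elements, each s in B has D(s,u) = R_A, the total weight of A, so that the loss is
(R_A - 1) R_B, the compensation for bridges and degree-1 vertices. At an articulation vertex each
local copy retains the sources of its own branch; the branches partition the sources, so nothing is
lost.

A side vertex u is interior to no shortest path, so its removal leaves all pair dependencies among
the other vertices intact. The lost pairs have u as source or as target; by the symmetry of δ_st,
one search from u yields both contributions (`IsSide.weightedScore_removeSide`). -/

namespace BC

/-! ### Distances and vertices on shortest paths -/

section Geodesics

variable {α : Type*} {G : SimpleGraph α}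

/-- `v` lies on a shortest path from `s` to `t`. -/
def OnGeodesic (G : SimpleGraph α) (s t v : α) : Prop :=
  G.Reachable s v ∧ G.Reachable v t ∧ G.dist s v + G.dist v t = G.dist s t

theorem OnGeodesic.symm {s t v : α} (h : OnGeodesic G s t v) : OnGeodesic G t s v :=
  ⟨h.2.1.symm, h.1.symm, by
    rw [G.dist_comm (u := t), G.dist_comm (v := s), G.dist_comm (u := t), ← h.2.2, add_comm]⟩

theorem onGeodesic_right {s t : α} (h : G.Reachable s t) : OnGeodesic G s t t :=
  ⟨h, .rfl, by simp⟩

theorem dist_le_dist_add_one {s v w : α} (h : G.Reachable s v) (hvw : G.Adj v w) :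
    G.dist s w ≤ G.dist s v + 1 :=
  (h.dist_triangle_left w).trans_eq (by rw [SimpleGraph.dist_eq_one_iff_adj.2 hvw])

theorem exists_adj_dist_add_one {s t : α} (h : G.Reachable s t) (hne : s ≠ t) :
    ∃ v, G.Adj v t ∧ G.Reachable s v ∧ G.dist s v + 1 = G.dist s t := by
  obtain ⟨p, hp⟩ := h.symm.exists_walk_length_eq_dist
  cases p with
  | nil => exact absurd rfl hne
  | @cons _ v _ hv q =>
    refine ⟨v, hv.symm, q.reachable.symm, ?_⟩
    have h1 := G.dist_le q
    have h2 := dist_le_dist_add_one q.reachable.symm hv.symm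
    rw [SimpleGraph.Walk.length_cons, G.dist_comm] at hp
    rw [G.dist_comm] at h1
    omega

/-- Together with `OnGeodesic.of_adj` this identifies the steps from v towards t with the steps away
from s that remain on a geodesic to t. -/
theorem OnGeodesic.trans_adj {s t v w : α} (h : OnGeodesic G s t v) (hvw : G.Adj v w)
    (hw : G.dist w t + 1 = G.dist v t) :
    G.dist s w = G.dist s v + 1 ∧ OnGeodesic G s t w := by
  have h1 := dist_le_dist_add_one h.1 hvw
  have hsw : G.Reachable s w := h.1.trans hvw.reachable
  have h2 := hsw.dist_triangle_left t
  have h3 := h.2.2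
  exact ⟨by omega, hsw, hvw.symm.reachable.trans h.2.1, by omega⟩

theorem OnGeodesic.of_adj {s t v w : α} (hv : G.Reachable s v) (hvw : G.Adj v w)
    (hd : G.dist s w = G.dist s v + 1) (h : OnGeodesic G s t w) :
    OnGeodesic G s t v ∧ G.dist w t + 1 = G.dist v t := by
  have h1 := dist_le_dist_add_one h.2.1.symm hvw.symm
  rw [G.dist_comm, G.dist_comm (u := t)] at h1
  have h2 := hv.dist_triangle_left t
  have h3 := h.2.2
  exact ⟨⟨hv, hvw.reachable.trans h.2.1, by omega⟩, by omega⟩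

end Geodesics

/-! ### Numbers of shortest paths, pair dependencies and their recursion -/

section Counting

variable {α : Type*} {G : SimpleGraph α} {W : Finset α}

/-- Walks of length `n + 1` from `s` consist of an edge and a walk of length `n`. -/
def walkSuccEquiv (hW : ∀ ⦃x y⦄, G.Adj x y → x ∈ W) (n : ℕ) (s t : α) :
    {p : G.Walk s t // p.length = n + 1} ≃
      Σ w : {w // w ∈ {w : W | G.Adj s w}}, {p : G.Walk (w : W) t // p.length = n} where
  toFun
    | ⟨.cons (v := v) h q, hp⟩ => ⟨⟨⟨v, hW h.symm⟩, h⟩, ⟨q, by simpa using hp⟩⟩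
  invFun x := ⟨.cons x.1.2 x.2.1, by simp [x.2.2]⟩
  left_inv := by
    rintro ⟨_ | ⟨h, q⟩, hp⟩
    · simp at hp
    · rfl
  right_inv := by
    rintro ⟨⟨⟨w, hw⟩, h⟩, ⟨q, hq⟩⟩
    rfl

/-- `Nat.card` vanishes on infinite types, so finiteness has to be known. The vertex type may be
infinite (copies carry an index in ℕ), but all edges live on the finite set W. -/
theorem finite_walk_length (hW : ∀ ⦃x y⦄, G.Adj x y → x ∈ W) (n : ℕ) (s t : α) :
    Finite {p : G.Walk s t // p.length = n} := by
  induction n generalizing s with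
  | zero =>
    refine @Finite.of_subsingleton _ ⟨?_⟩
    rintro ⟨p, hp⟩ ⟨q, hq⟩
    cases p with
    | nil => cases q with
      | nil => rfl
      | cons => simp at hq
    | cons => simp at hp
  | succ n ih =>
    have := ih
    exact Finite.of_equiv _ (walkSuccEquiv hW n s t).symm

open scoped Classical in
theorem card_walk_length_succ (hW : ∀ ⦃x y⦄, G.Adj x y → x ∈ W) (n : ℕ) (s t : α) :
    Nat.card {p : G.Walk s t // p.length = n + 1} =
      ∑ w ∈ W with G.Adj s w, Nat.card {p : G.Walk w t // p.length = n} := by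
  have := fun s => finite_walk_length hW n s t
  rw [Nat.card_congr (walkSuccEquiv hW n s t), Nat.card_sigma]
  refine Finset.sum_bij (fun x _ => (x.1 : α)) ?_ ?_ ?_ ?_
  · rintro ⟨⟨w, hw⟩, h⟩ -
    exact Finset.mem_filter.2 ⟨hw, h⟩
  · rintro ⟨⟨w, hw⟩, h⟩ - ⟨⟨w', hw'⟩, h'⟩ - rfl
    rfl
  · intro w hw
    rw [Finset.mem_filter] at hw
    exact ⟨⟨⟨w, hw.1⟩, hw.2⟩, Finset.mem_univ _, rfl⟩
  · intros
    rfl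

theorem numShortest_self (s : α) : numShortest G s s = 1 := by
  rw [numShortest, Nat.card_eq_one_iff_exists]
  refine ⟨⟨.nil, by simp⟩, ?_⟩
  rintro ⟨p, hp⟩
  cases p with
  | nil => rfl
  | cons => simp at hp

theorem numShortest_eq_zero {s t : α} (h : ¬ G.Reachable s t) : numShortest G s t = 0 := by
  rw [numShortest, Nat.card_eq_zero]
  exact .inl ⟨fun p => h p.1.reachable⟩

theorem numShortest_pos (hW : ∀ ⦃x y⦄, G.Adj x y → x ∈ W) {s t : α} (h : G.Reachable s t) :
    0 < numShortest G s t := by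
  have := finite_walk_length hW (G.dist s t) s t
  obtain ⟨p, hp⟩ := h.exists_walk_length_eq_dist
  exact Nat.card_pos_iff.2 ⟨⟨⟨p, hp⟩⟩, this⟩

theorem numShortest_comm (s t : α) : numShortest G s t = numShortest G t s :=
  Nat.card_congr
    { toFun := fun p => ⟨p.1.reverse, by rw [SimpleGraph.Walk.length_reverse, p.2, G.dist_comm]⟩
      invFun := fun p => ⟨p.1.reverse, by rw [SimpleGraph.Walk.length_reverse, p.2, G.dist_comm]⟩
      left_inv := fun p => by simp
      right_inv := fun p => by simp }

open scoped Classical in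
/-- Shortest paths are counted by their first step. -/
theorem numShortest_eq_sum (hW : ∀ ⦃x y⦄, G.Adj x y → x ∈ W) {s t : α} (hne : s ≠ t) :
    numShortest G s t =
      ∑ w ∈ W with G.Adj s w ∧ G.dist w t + 1 = G.dist s t, numShortest G w t := by
  by_cases h : G.Reachable s t
  · have hpos := h.pos_dist_of_ne hne
    obtain ⟨n, hn⟩ : ∃ n, G.dist s t = n + 1 := ⟨G.dist s t - 1, by omega⟩
    rw [numShortest, hn, card_walk_length_succ hW]
    symm
    refine Finset.sum_subset_zero_on_sdiff ?_ ?_ ?_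
    · intro w
      simp only [Finset.mem_filter]
      tauto
    · intro w hw
      simp only [Finset.mem_sdiff, Finset.mem_filter, not_and] at hw
      rw [Nat.card_eq_zero]
      -- A neighbour w of s with a walk of length n to t has distance exactly n from t: at most n by
      -- the walk, at least n by the triangle inequality.
      refine .inl ⟨fun ⟨p, hp⟩ => hw.2 hw.1.1 hw.1.2 ?_⟩
      have h1 := G.dist_le p
      have h2 := dist_le_dist_add_one p.reachable.symm hw.1.2.symm
      rw [G.dist_comm, G.dist_comm (u := t)] at h2
      omega
    · intro w hw
      simp only [Finset.mem_filter] at hw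
      rw [numShortest, show G.dist w t = n by omega]
  · rw [numShortest_eq_zero h, Finset.sum_eq_zero]
    intro w hw
    simp only [Finset.mem_filter] at hw
    exact numShortest_eq_zero fun h' => h (hw.2.1.reachable.trans h')

open scoped Classical in
/-- Shortest paths are counted by their last step. -/
theorem numShortest_eq_sum' (hW : ∀ ⦃x y⦄, G.Adj x y → x ∈ W) {s t : α} (hne : s ≠ t) :
    numShortest G s t =
      ∑ v ∈ W with G.Adj v t ∧ G.dist s v + 1 = G.dist s t, numShortest G s v := by
  rw [numShortest_comm, numShortest_eq_sum hW hne.symm]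
  refine Finset.sum_congr (Finset.filter_congr fun w _ => ?_) fun w _ => numShortest_comm _ _
  rw [G.adj_comm, G.dist_comm, G.dist_comm (u := t)]

/-- The common length of the first parts fixes the cut; this gives injectivity when shortest paths
through v are glued from two halves. -/
theorem walk_append_inj {s v t : α} {p p' : G.Walk s v} {q q' : G.Walk v t}
    (hl : p.length = p'.length) (h : p.append q = p'.append q') : p = p' ∧ q = q' := by
  induction p with
  | nil =>
    cases p' with
    | nil => exact ⟨rfl, h⟩
    | cons => simp at hl
  | cons hv p ih =>
    cases p' with
    | nil => simp at hl
    | cons hv' p' =>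
      rw [SimpleGraph.Walk.cons_append, SimpleGraph.Walk.cons_append,
        SimpleGraph.Walk.cons.injEq] at h
      obtain ⟨rfl, h⟩ := h
      obtain ⟨rfl, rfl⟩ := ih (by simpa using hl) (eq_of_heq h)
      exact ⟨rfl, rfl⟩

/-- Cut the path at v: the halves are no shorter than the distances, and by the triangle inequality
their total length leaves no slack. -/
theorem onGeodesic_of_mem_support {s t v : α} {p : G.Walk s t} (hp : p.length = G.dist s t)
    (hv : v ∈ p.support) :
    OnGeodesic G s t v ∧ ∃ (q : G.Walk s v) (q' : G.Walk v t), q.length = G.dist s v ∧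
      q'.length = G.dist v t ∧ q.append q' = p := by
  classical
  have h := congrArg SimpleGraph.Walk.length (p.take_spec hv)
  rw [SimpleGraph.Walk.length_append] at h
  have h1 := G.dist_le (p.takeUntil v hv)
  have h2 := G.dist_le (p.dropUntil v hv)
  have h3 := (p.takeUntil v hv).reachable.dist_triangle_left t
  exact ⟨⟨(p.takeUntil v hv).reachable, (p.dropUntil v hv).reachable, by omega⟩,
    p.takeUntil v hv, p.dropUntil v hv, by omega, by omega, p.take_spec hv⟩

theorem numShortestThrough_of_onGeodesic {s t v : α} (h : OnGeodesic G s t v) :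
    numShortestThrough G s t v = numShortest G s v * numShortest G v t := by
  rw [numShortest, numShortest, ← Nat.card_prod, numShortestThrough]
  symm
  refine Nat.card_congr (Equiv.ofBijective
    (fun x => ⟨x.1.1.append x.2.1, ?_, ?_⟩) ⟨?_, ?_⟩)
  · rw [SimpleGraph.Walk.length_append, x.1.2, x.2.2, h.2.2]
  · exact SimpleGraph.Walk.mem_support_append_iff _ _ |>.2 (.inl (SimpleGraph.Walk.end_mem_support _))
  · rintro ⟨⟨p, hp⟩, ⟨q, hq⟩⟩ ⟨⟨p', hp'⟩, ⟨q', hq'⟩⟩ he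
    obtain ⟨rfl, rfl⟩ := walk_append_inj (hp.trans hp'.symm) (Subtype.ext_iff.1 he)
    rfl
  · rintro ⟨p, hp, hv⟩
    obtain ⟨-, q, q', hq, hq', he⟩ := onGeodesic_of_mem_support hp hv
    exact ⟨⟨⟨q, hq⟩, ⟨q', hq'⟩⟩, Subtype.ext he⟩

theorem numShortestThrough_eq_zero {s t v : α} (h : ¬ OnGeodesic G s t v) :
    numShortestThrough G s t v = 0 := by
  rw [numShortestThrough, Nat.card_eq_zero]
  exact .inl ⟨fun p => h (onGeodesic_of_mem_support p.2.1 p.2.2).1⟩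

theorem pairDependency_of_onGeodesic {s t v : α} (h : OnGeodesic G s t v) :
    pairDependency G s t v =
      (numShortest G s v : ℚ) * numShortest G v t / numShortest G s t := by
  rw [pairDependency, numShortestThrough_of_onGeodesic h, Nat.cast_mul]

theorem pairDependency_eq_zero {s t v : α} (h : ¬ OnGeodesic G s t v) :
    pairDependency G s t v = 0 := by
  rw [pairDependency, numShortestThrough_eq_zero h, Nat.cast_zero, zero_div]

theorem pairDependency_comm (s t v : α) : pairDependency G s t v = pairDependency G t s v := by
  by_cases h : OnGeodesic G s t v
  · rw [pairDependency_of_onGeodesic h, pairDependency_of_onGeodesic h.symm,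
      numShortest_comm s v, numShortest_comm v t, numShortest_comm s t, mul_comm]
  · rw [pairDependency_eq_zero h, pairDependency_eq_zero (mt OnGeodesic.symm h)]

/-- The target itself counts fully. This is the source of the initial value of δ and of the -1 in
the score. -/
theorem pairDependency_right (hW : ∀ ⦃x y⦄, G.Adj x y → x ∈ W) {s t : α}
    (h : G.Reachable s t) : pairDependency G s t t = 1 := by
  have := numShortest_pos hW h
  rw [pairDependency_of_onGeodesic (onGeodesic_right h), numShortest_self]
  field_simp
  simp

theorem pairDependency_self {s v : α} (h : v ≠ s) : pairDependency G s s v = 0 := by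
  refine pairDependency_eq_zero fun ⟨h1, _, h2⟩ => h ?_
  rw [SimpleGraph.dist_self, Nat.add_eq_zero_iff, h1.dist_eq_zero_iff] at h2
  exact h2.1.symm

theorem pairDependency_eq_zero_of_not_reachable {s t v : α} (h : ¬ G.Reachable s v) :
    pairDependency G s t v = 0 :=
  pairDependency_eq_zero fun h' => h h'.1

open scoped Classical in
/-- The recursion for pair dependencies on which the algorithm of Brandes is based. -/
theorem pairDependency_eq_sum (hW : ∀ ⦃x y⦄, G.Adj x y → x ∈ W) {s t v : α}
    (hv : G.Reachable s v) (hne : v ≠ t) :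
    pairDependency G s t v =
      ∑ w ∈ W with G.Adj v w ∧ G.dist s w = G.dist s v + 1,
        (numShortest G s v : ℚ) / numShortest G s w * pairDependency G s t w := by
  by_cases h : OnGeodesic G s t v
  · rw [pairDependency_of_onGeodesic h, numShortest_eq_sum hW hne, Nat.cast_sum, Finset.mul_sum,
      Finset.sum_div]
    -- The sum may be extended from the steps towards t to all steps away from s: the additional w
    -- lie on no geodesic to t and contribute 0.
    refine Finset.sum_subset_zero_on_sdiff ?_ ?_ ?_
    · intro w hw
      simp only [Finset.mem_filter] at hw ⊢
      exact ⟨hw.1, hw.2.1, (h.trans_adj hw.2.1 hw.2.2).1⟩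
    · intro w hw
      simp only [Finset.mem_sdiff, Finset.mem_filter] at hw
      rw [pairDependency_eq_zero, mul_zero]
      exact fun h' => hw.2 ⟨hw.1.1, hw.1.2.1, (h'.of_adj hv hw.1.2.1 hw.1.2.2).2⟩
    · intro w hw
      simp only [Finset.mem_filter] at hw
      have h' := (h.trans_adj hw.2.1 hw.2.2).2
      have := numShortest_pos hW h'.1
      rw [pairDependency_of_onGeodesic h']
      field_simp
  · rw [pairDependency_eq_zero h, Finset.sum_eq_zero]
    intro w hw
    simp only [Finset.mem_filter] at hw
    rw [pairDependency_eq_zero, mul_zero]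
    exact fun h' => h (h'.of_adj hv hw.2.1 hw.2.2).1

/-- The weighted dependency of the source `s` on `v`. -/
noncomputable def dependency (G : SimpleGraph α) (W : Finset α) (r : α → ℚ) (s v : α) : ℚ :=
  ∑ t ∈ W, r t * pairDependency G s t v

open scoped Classical in
-- The recursion for a single target fails only at t = v. That target gives the summand r(v), and it
-- contributes nothing on the right, since the successors of v are farther from s than v.
theorem dependency_eq_sum (hW : ∀ ⦃x y⦄, G.Adj x y → x ∈ W) {r : α → ℚ} {s v : α}
    (hvW : v ∈ W) (hv : G.Reachable s v) :
    dependency G W r s v = r v + ∑ w ∈ W with G.Adj v w ∧ G.dist s w = G.dist s v + 1,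
      (numShortest G s v : ℚ) / numShortest G s w * dependency G W r s w := by
  simp only [dependency, Finset.mul_sum]
  rw [Finset.sum_comm, ← Finset.add_sum_erase _ _ hvW,
    ← Finset.add_sum_erase (f := fun t => ∑ w ∈ W with G.Adj v w ∧ G.dist s w = G.dist s v + 1,
      (numShortest G s v : ℚ) / numShortest G s w * (r t * pairDependency G s t w)) _ hvW,
    pairDependency_right hW hv, Finset.sum_eq_zero (s := Finset.filter _ _), zero_add, mul_one]
  · congr 1
    refine Finset.sum_congr rfl fun t ht => ?_
    rw [pairDependency_eq_sum hW hv (Finset.ne_of_mem_erase ht).symm, Finset.mul_sum]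
    exact Finset.sum_congr rfl fun w _ => by ring
  · intro w hw
    simp only [Finset.mem_filter] at hw
    rw [pairDependency_eq_zero, mul_zero, mul_zero]
    intro h
    have := h.2.2
    omega

end Counting

/-! ### Correctness of the breadth first search -/

section Search

variable {α : Type*} [DecidableEq α] {G : SimpleGraph α} {W : Finset α}

/-- The loop over the neighbours in closed form: as v is not in the list and the list has no
repetitions, d[v] and σ[v] stay constant and every other entry is changed at most once. -/
theorem foldl_countPaths_discover (v : α) (l : List α) (st : BfsState α) (hl : l.Nodup)
    (hv : v ∉ l) (hd : 0 ≤ st.dist v) :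
    let st' := l.foldl (fun st w => countPaths v w (discover v w st)) st
    st'.queue = st.queue ++ l.filter (fun w => st.dist w < 0) ∧ st'.stack = st.stack ∧
    (∀ x, st'.dist x = if x ∈ l ∧ st.dist x < 0 then st.dist v + 1 else st.dist x) ∧
    (∀ x, st'.sigma x = if x ∈ l ∧ (st.dist x < 0 ∨ st.dist x = st.dist v + 1) then
      st.sigma x + st.sigma v else st.sigma x) ∧
    (∀ x, st'.pred x = if x ∈ l ∧ (st.dist x < 0 ∨ st.dist x = st.dist v + 1) then
      st.pred x ++ [v] else st.pred x) := by
  induction l generalizing st with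
  | nil => simp
  | cons w l ih =>
    obtain ⟨hwl, hl⟩ := List.nodup_cons.1 hl
    have hvw : v ≠ w := List.ne_of_not_mem_cons hv
    have hv : v ∉ l := List.not_mem_of_not_mem_cons hv
    set st₁ := countPaths v w (discover v w st) with hst₁
    have hq : st₁.queue = st.queue ++ if st.dist w < 0 then [w] else [] := by
      simp only [hst₁, countPaths, discover]
      split_ifs <;> simp_all
    have hs : st₁.stack = st.stack := by
      simp only [hst₁, countPaths, discover]
      split_ifs <;> simp_all
    have hdist : ∀ x, st₁.dist x = if x = w ∧ st.dist x < 0 then st.dist v + 1 else st.dist x := by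
      intro x
      simp only [hst₁, countPaths, discover]
      split_ifs <;> simp_all <;> grind
    have hsig : ∀ x, st₁.sigma x =
        if x = w ∧ (st.dist x < 0 ∨ st.dist x = st.dist v + 1) then st.sigma x + st.sigma v
        else st.sigma x := by
      intro x
      simp only [hst₁, countPaths, discover]
      split_ifs <;> simp_all <;> grind
    have hpred : ∀ x, st₁.pred x =
        if x = w ∧ (st.dist x < 0 ∨ st.dist x = st.dist v + 1) then st.pred x ++ [v]
        else st.pred x := by
      intro x
      simp only [hst₁, countPaths, discover]
      split_ifs <;> simp_all <;> grind
    have hdv : st₁.dist v = st.dist v := by rw [hdist, if_neg (fun h => hvw h.1)]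
    have hsv : st₁.sigma v = st.sigma v := by rw [hsig, if_neg (fun h => hvw h.1)]
    obtain ⟨i1, i2, i3, i4, i5⟩ := ih st₁ hl hv (hdv ▸ hd)
    have hne : ∀ x ∈ l, x ≠ w := fun x hx h => hwl (h ▸ hx)
    have hdl : ∀ x ∈ l, st₁.dist x = st.dist x := fun x hx => by
      rw [hdist, if_neg (fun h => hne x hx h.1)]
    rw [List.foldl_cons]
    refine ⟨?_, i2.trans hs, fun x => ?_, fun x => ?_, fun x => ?_⟩
    · rw [i1, hq, List.filter_congr (fun x hx => by rw [hdl x hx]), List.filter_cons]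
      by_cases hw : st.dist w < 0 <;> simp [hw]
    · rw [i3, hdv, hdist]
      by_cases hx : x ∈ l
      · simp [hx, hne x hx]
      · simp [hx]
    · rw [i4, hdv, hsv, hsig, hdist]
      by_cases hx : x ∈ l
      · simp [hx, hne x hx]
      · simp [hx]
    · rw [i5, hdv, hpred, hdist]
      by_cases hx : x ∈ l
      · simp [hx, hne x hx]
      · simp [hx]

/-- The loop invariant of the breadth first search from `s`. -/
structure BfsInvariant (G : SimpleGraph α) (s : α) (st : BfsState α) : Prop where
  nodup : (st.stack.reverse ++ st.queue).Nodup
  sorted : (st.stack.reverse ++ st.queue).Pairwise fun a b => G.dist s a ≤ G.dist s b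
  reachable : ∀ x, x ∈ st.stack ∨ x ∈ st.queue → G.Reachable s x
  start : s ∈ st.stack ∨ s ∈ st.queue
  closed : ∀ y ∈ st.stack, ∀ x, G.Adj y x → x ∈ st.stack ∨ x ∈ st.queue
  near : ∀ x ∈ st.queue, ∀ y ∈ st.queue, G.dist s x ≤ G.dist s y + 1
  dist_eq : ∀ x, x ∈ st.stack ∨ x ∈ st.queue → st.dist x = G.dist s x
  dist_neg : ∀ x, ¬ (x ∈ st.stack ∨ x ∈ st.queue) → st.dist x = -1
  pred_nodup : ∀ x, (st.pred x).Nodup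
  mem_pred : ∀ x v, v ∈ st.pred x ↔ v ∈ st.stack ∧ G.Adj v x ∧ G.dist s v + 1 = G.dist s x
  sigma_eq : ∀ x, st.sigma x =
    (if x = s then 1 else 0) + ((st.pred x).map (numShortest G s)).sum

theorem bfsInvariant_bfsStart (s : α) : BfsInvariant G s (bfsStart s) where
  nodup := by simp [bfsStart]
  sorted := by simp [bfsStart]
  reachable := by simp [bfsStart]
  start := by simp [bfsStart]
  closed := by simp [bfsStart]
  near := by simp [bfsStart]
  dist_eq := by simp [bfsStart]
  dist_neg := by simp +contextual [bfsStart]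
  pred_nodup := by simp [bfsStart]
  mem_pred := by simp [bfsStart]
  sigma_eq := by simp [bfsStart, Function.update_apply]

namespace BfsInvariant

variable {s : α} {st : BfsState α}

/-- The queue is the frontier: a geodesic from s to an unprocessed vertex has to leave the
closed-off stack through the queue. -/
theorem exists_mem_queue (h : BfsInvariant G s st) {x : α} (hx : G.Reachable s x)
    (hxs : x ∉ st.stack) : ∃ y ∈ st.queue, G.dist s y ≤ G.dist s x := by
  induction hn : G.dist s x generalizing x with
  | zero =>
    rw [hx.dist_eq_zero_iff] at hn
    subst hn
    exact ⟨s, h.start.resolve_left hxs, by simp⟩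
  | succ n ih =>
    obtain ⟨v, hvx, hv, hd⟩ := exists_adj_dist_add_one hx (by rintro rfl; simp at hn)
    by_cases hvs : v ∈ st.stack
    · exact ⟨x, (h.closed v hvs x hvx).resolve_left hxs, hn.le⟩
    · obtain ⟨y, hy, hyd⟩ := ih hv hvs (by omega)
      exact ⟨y, hy, by omega⟩

/-- Once all predecessors of x have been processed, the list P[x] is complete and σ[x] is the count
by the last step. -/
theorem sigma_eq_numShortest (hW : ∀ ⦃x y⦄, G.Adj x y → x ∈ W) (h : BfsInvariant G s st) {x : α}
    (hx : ∀ v, G.Adj v x → G.dist s v + 1 = G.dist s x → v ∈ st.stack) :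
    st.sigma x = numShortest G s x := by
  classical
  rw [h.sigma_eq]
  split_ifs with hxs
  · subst hxs
    rw [numShortest_self, (List.eq_nil_iff_forall_not_mem.2 fun v hv => by
      simpa using ((h.mem_pred _ _).1 hv).2.2 : st.pred x = [])]
    simp
  · rw [zero_add, numShortest_eq_sum' hW (Ne.symm hxs), ← List.sum_toFinset _ (h.pred_nodup x)]
    refine Finset.sum_congr (Finset.ext fun v => ?_) fun _ _ => rfl
    rw [List.mem_toFinset, h.mem_pred, Finset.mem_filter]
    exact ⟨fun h => ⟨hW h.2.1, h.2⟩, fun h => ⟨hx v h.2.1 h.2.2, h.2⟩⟩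

/-- The head v of the queue is a nearest unprocessed vertex. Hence σ[v] is final when it is passed
on, and the vertices discovered from v have distance exactly d(s,v) + 1. -/
theorem step (hW : ∀ ⦃x y⦄, G.Adj x y → x ∈ W) (h : BfsInvariant G s st) {nbr : α → List α}
    (nbr_nodup : ∀ v, (nbr v).Nodup) (mem_nbr : ∀ v w, w ∈ nbr v ↔ G.Adj v w) {v : α}
    {q : List α} (hq : st.queue = v :: q) :
    BfsInvariant G s (bfsStep nbr st) ∧ (bfsStep nbr st).stack = v :: st.stack := by
  classical
  have hvQ : v ∈ st.queue := by simp [hq]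
  have hdv := h.dist_eq v (.inr hvQ)
  have hvr := h.reachable v (.inr hvQ)
  have hstep : bfsStep nbr st = (nbr v).foldl (fun st w => countPaths v w (discover v w st))
      { st with queue := q, stack := v :: st.stack } := by
    rw [bfsStep, hq]
  obtain ⟨i1, i2, i3, i4, i5⟩ := foldl_countPaths_discover v (nbr v)
    { st with queue := q, stack := v :: st.stack } (nbr_nodup v)
    (fun hv => (G.loopless.irrefl v) ((mem_nbr v v).1 hv)) (by simp [hdv])
  rw [← hstep] at i1 i2 i3 i4 i5
  simp only [mem_nbr] at i1 i2 i3 i4 i5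
  have hneg : ∀ x, st.dist x < 0 ↔ ¬ (x ∈ st.stack ∨ x ∈ st.queue) := fun x => by
    refine ⟨fun hx hx' => ?_, fun hx => ?_⟩
    · rw [h.dist_eq x hx'] at hx
      omega
    · rw [h.dist_neg x hx]
      omega
  have hsorted := h.sorted
  rw [List.pairwise_append, hq, List.pairwise_cons] at hsorted
  obtain ⟨so1, ⟨so2, so3⟩, so4⟩ := hsorted
  have hmin : ∀ y ∈ st.queue, G.dist s v ≤ G.dist s y := by
    rw [hq]
    simpa using so2
  -- A predecessor u of an undiscovered x cannot be on the stack, since x would then have been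
  -- discovered; so u is no nearer to s than the head of the queue.
  have hnew : ∀ x, G.Adj v x → ¬ (x ∈ st.stack ∨ x ∈ st.queue) →
      G.dist s x = G.dist s v + 1 := by
    intro x hvx hx
    have hxr : G.Reachable s x := hvr.trans hvx.reachable
    refine le_antisymm (dist_le_dist_add_one hvr hvx) ?_
    obtain ⟨u, hux, hu, hd⟩ := exists_adj_dist_add_one hxr (by rintro rfl; exact hx h.start)
    have hus : u ∉ st.stack := fun hus => hx (h.closed u hus x hux)
    obtain ⟨y, hy, hyd⟩ := h.exists_mem_queue hu hus
    have := hmin y hy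
    omega
  -- An unprocessed predecessor of v would force a queue entry nearer to s than v.
  have hpv : ∀ u, G.Adj u v → G.dist s u + 1 = G.dist s v → u ∈ st.stack := by
    intro u huv hd
    by_contra hus
    obtain ⟨y, hy, hyd⟩ := h.exists_mem_queue (hvr.trans huv.symm.reachable) hus
    have := hmin y hy
    omega
  have hsv := h.sigma_eq_numShortest hW hpv
  have hcond : ∀ x, (G.Adj v x ∧ (st.dist x < 0 ∨ st.dist x = st.dist v + 1)) ↔
      G.Adj v x ∧ G.dist s v + 1 = G.dist s x := by
    intro x
    refine and_congr_right fun hvx => ?_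
    by_cases hx : x ∈ st.stack ∨ x ∈ st.queue
    · rw [h.dist_eq x hx, hdv]
      omega
    · have := hnew x hvx hx
      simp only [(hneg x).2 hx, true_or, true_iff]
      omega
  have hnd := h.nodup
  rw [hq] at hnd
  have hvs : v ∉ st.stack := fun hvs => by
    rw [List.nodup_append] at hnd
    exact hnd.2.2 v (List.mem_reverse.2 hvs) v List.mem_cons_self rfl
  have hmem : ∀ x, x ∈ (bfsStep nbr st).stack ∨ x ∈ (bfsStep nbr st).queue ↔
      (x ∈ st.stack ∨ x ∈ st.queue) ∨ G.Adj v x ∧ ¬ (x ∈ st.stack ∨ x ∈ st.queue) := by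
    intro x
    rw [i1, i2, List.mem_append, List.mem_filter, mem_nbr, List.mem_cons]
    simp only [decide_eq_true_eq, hneg]
    rw [hq, List.mem_cons]
    tauto
  have hnewmem : ∀ x ∈ (nbr v).filter (fun w => st.dist w < 0),
      G.Adj v x ∧ ¬ (x ∈ st.stack ∨ x ∈ st.queue) := by
    intro x hx
    simpa only [List.mem_filter, mem_nbr, decide_eq_true_eq, hneg] using hx
  have hlist : (bfsStep nbr st).stack.reverse ++ (bfsStep nbr st).queue =
      (st.stack.reverse ++ st.queue) ++ (nbr v).filter (fun w => st.dist w < 0) := by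
    rw [i1, i2, hq]
    simp
  have hqd : ∀ x ∈ (bfsStep nbr st).queue,
      G.dist s v ≤ G.dist s x ∧ G.dist s x ≤ G.dist s v + 1 := by
    intro x hx
    rw [i1, List.mem_append] at hx
    rcases hx with hx | hx
    · have hx' : x ∈ st.queue := by rw [hq]; exact List.mem_cons_of_mem _ hx
      exact ⟨hmin x hx', h.near x hx' v hvQ⟩
    · have := hnew x (hnewmem x hx).1 (hnewmem x hx).2
      omega
  refine ⟨?_, i2⟩
  constructor
  · rw [hlist, List.nodup_append]
    refine ⟨h.nodup, (nbr_nodup v).filter _, ?_⟩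
    rintro a ha b hb rfl
    exact (hnewmem a hb).2 (by simpa using ha)
  · rw [hlist, List.pairwise_append]
    refine ⟨h.sorted, List.pairwise_of_forall_mem_list fun a ha b hb => ?_, fun a ha b hb => ?_⟩
    · rw [hnew a (hnewmem a ha).1 (hnewmem a ha).2, hnew b (hnewmem b hb).1 (hnewmem b hb).2]
    · rw [hnew b (hnewmem b hb).1 (hnewmem b hb).2]
      rw [List.mem_append, List.mem_reverse] at ha
      rcases ha with ha | ha
      · exact (so4 a (List.mem_reverse.2 ha) v (by simp)).trans (Nat.le_succ _)
      · exact h.near a ha v hvQ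
  · intro x hx
    rcases (hmem x).1 hx with hx | hx
    · exact h.reachable x hx
    · exact hvr.trans hx.1.reachable
  · exact (hmem s).2 (.inl h.start)
  · intro y hy x hyx
    rw [hmem]
    rw [i2, List.mem_cons] at hy
    rcases hy with rfl | hy
    · tauto
    · exact .inl (h.closed y hy x hyx)
  · intro x hx y hy
    have h1 := hqd x hx
    have h2 := hqd y hy
    omega
  · intro x hx
    rw [hmem] at hx
    rw [i3]
    simp only [hneg]
    split_ifs with hc
    · rw [hnew x hc.1 hc.2, hdv]
      simp
    · exact h.dist_eq x (hx.resolve_right hc)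
  · intro x hx
    rw [hmem, not_or] at hx
    rw [i3]
    simp only [hneg]
    rw [if_neg hx.2, h.dist_neg x hx.1]
  · intro x
    rw [i5]
    split_ifs
    · rw [List.nodup_append]
      refine ⟨h.pred_nodup x, by simp, ?_⟩
      rintro a ha b hb rfl
      rw [List.mem_singleton] at hb
      exact hvs (hb ▸ ((h.mem_pred _ _).1 ha).1)
    · exact h.pred_nodup x
  · intro x u
    rw [i5, i2]
    simp only [hcond, List.mem_cons]
    split_ifs with hc
    · rw [List.mem_append, h.mem_pred, List.mem_singleton]
      grind
    · rw [h.mem_pred]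
      grind
  · intro x
    rw [i4, i5]
    simp only [hcond]
    split_ifs with hc hxs hxs
    · rw [h.sigma_eq, if_pos hxs, hsv]
      simp [add_assoc]
    · rw [h.sigma_eq, if_neg hxs, hsv]
      simp
    · rw [h.sigma_eq, if_pos hxs]
    · rw [h.sigma_eq, if_neg hxs]

end BfsInvariant

/-- Each iteration pushes one vertex on the stack until the queue is empty, after which iterations
do nothing. -/
theorem bfsInvariant_iterate (hW : ∀ ⦃x y⦄, G.Adj x y → x ∈ W) (s : α) {nbr : α → List α}
    (nbr_nodup : ∀ v, (nbr v).Nodup) (mem_nbr : ∀ v w, w ∈ nbr v ↔ G.Adj v w) (n : ℕ) :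
    BfsInvariant G s ((bfsStep nbr)^[n] (bfsStart s)) ∧
      (((bfsStep nbr)^[n] (bfsStart s)).queue = [] ∨
        ((bfsStep nbr)^[n] (bfsStart s)).stack.length = n) := by
  induction n with
  | zero => exact ⟨bfsInvariant_bfsStart s, .inr rfl⟩
  | succ n ih =>
    rw [Function.iterate_succ_apply']
    set st := (bfsStep nbr)^[n] (bfsStart s)
    rcases hq : st.queue with _ | ⟨v, q⟩
    · have : bfsStep nbr st = st := by rw [bfsStep, hq]
      rw [this]
      exact ⟨ih.1, .inl hq⟩
    · obtain ⟨h1, h2⟩ := ih.1.step hW nbr_nodup mem_nbr hq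
      refine ⟨h1, .inr ?_⟩
      rw [h2, List.length_cons, ih.2.resolve_left (by simp [hq])]

theorem mem_of_reachable (hW : ∀ ⦃x y⦄, G.Adj x y → x ∈ W) {s x : α} (hs : s ∈ W)
    (h : G.Reachable s x) : x ∈ W := by
  by_cases hx : s = x
  · exact hx ▸ hs
  · obtain ⟨v, hv, -⟩ := exists_adj_dist_add_one h hx
    exact hW hv.symm

/-- Correctness of the breadth first search. -/
theorem bfs_correct (hW : ∀ ⦃x y⦄, G.Adj x y → x ∈ W) (L : Listing W G) {s : α} (hs : s ∈ W) :
    (bfs L s).stack.Nodup ∧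
    (bfs L s).stack.Pairwise (fun a b => G.dist s b ≤ G.dist s a) ∧
    (∀ x, x ∈ (bfs L s).stack ↔ G.Reachable s x) ∧
    (∀ x, ((bfs L s).pred x).Nodup) ∧
    (∀ x v, v ∈ (bfs L s).pred x ↔
      G.Reachable s v ∧ G.Adj v x ∧ G.dist s v + 1 = G.dist s x) ∧
    (∀ x, G.Reachable s x → (bfs L s).sigma x = numShortest G s x) := by
  obtain ⟨h, hlen⟩ := bfsInvariant_iterate hW s L.nbr_nodup L.mem_nbr L.order.length
  change BfsInvariant G s (bfs L s) at h
  change (bfs L s).queue = [] ∨ (bfs L s).stack.length = _ at hlen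
  have hq : (bfs L s).queue = [] := by
    rcases hlen with hlen | hlen
    · exact hlen
    -- If the stack already has as many entries as there are vertices, no room is left in the queue,
    -- because stack and queue together are free of repetitions.
    · have hsub : (bfs L s).stack.reverse ++ (bfs L s).queue ⊆ L.order := by
        intro x hx
        rw [List.mem_append, List.mem_reverse] at hx
        exact (L.mem_order x).2 (mem_of_reachable hW hs (h.reachable x hx))
      have := (h.nodup.subperm hsub).length_le
      rw [List.length_append, List.length_reverse, hlen] at this
      exact List.length_eq_zero_iff.1 (by omega)
  have hmem : ∀ x, x ∈ (bfs L s).stack ↔ G.Reachable s x := by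
    refine fun x => ⟨fun hx => h.reachable x (.inl hx), fun hx => ?_⟩
    by_contra hxs
    obtain ⟨y, hy, -⟩ := h.exists_mem_queue hx hxs
    simp [hq] at hy
  have hnd := h.nodup
  have hso := h.sorted
  rw [hq, List.append_nil] at hnd hso
  refine ⟨List.nodup_reverse.1 hnd, List.pairwise_reverse.1 hso, hmem, h.pred_nodup,
    fun x v => by rw [h.mem_pred, hmem], fun x hx => ?_⟩
  exact h.sigma_eq_numShortest hW fun v hv _ => (hmem v).2 (hx.trans hv.symm.reachable)

end Search

/-! ### Correctness of the back propagation -/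

section Accumulation

variable {α : Type*} [DecidableEq α] {G : SimpleGraph α} {W : Finset α}

theorem accumulate_apply (st : BfsState α) (w : α) (hn : (st.pred w).Nodup) (hw : w ∉ st.pred w)
    (del : α → ℚ) (x : α) :
    accumulate st w del x = del x + if x ∈ st.pred w then
      (st.sigma x : ℚ) / st.sigma w * (1 + del w) else 0 := by
  rw [accumulate]
  revert hn hw
  generalize st.pred w = P
  intro hn hw
  induction P generalizing del with
  | nil => simp
  | cons v l ih =>
    obtain ⟨hvl, hl⟩ := List.nodup_cons.1 hn
    have hwv : w ≠ v := List.ne_of_not_mem_cons hw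
    rw [List.foldl_cons, ih _ hl (List.not_mem_of_not_mem_cons hw), Function.update_of_ne hwv]
    by_cases hx : x = v
    · subst hx
      simp [hvl]
    · simp [hx]

open scoped Classical in
/-- Correctness of the back propagation: each vertex `w ≠ s` that is reachable from `s` gets its
contribution. -/
theorem backPropagate_bfs (hW : ∀ ⦃x y⦄, G.Adj x y → x ∈ W) (L : Listing W G) {s : α}
    (hs : s ∈ W) (contrib : α → ℚ → ℚ) (r bc : α → ℚ) (x : α) :
    backPropagate (bfs L s) s contrib (fun v => r v - 1) bc x =
      bc x + if x ≠ s ∧ G.Reachable s x then contrib x (dependency G W r s x - 1) else 0 := by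
  obtain ⟨hnd, hso, hmem, hpn, hmp, hsig⟩ := bfs_correct hW L hs
  set st := bfs L s
  -- Loop invariant: P holds the vertices already popped and l those to come. The value δ[y] has
  -- received the summands of exactly those successors of y that lie in P.
  have key : ∀ (l P : List α), st.stack = P ++ l → ∀ del bc : α → ℚ,
      (∀ y, del y = r y - 1 + ∑ w ∈ P.toFinset with y ∈ st.pred w,
        (numShortest G s y : ℚ) / numShortest G s w * dependency G W r s w) →
      (l.foldl (fun (x : (α → ℚ) × (α → ℚ)) w =>
        let del' := accumulate st w x.1
        (del', if w ≠ s then Function.update x.2 w (x.2 w + contrib w (del' w)) else x.2))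
        (del, bc)).2 x =
      bc x + if x ≠ s ∧ x ∈ l then contrib x (dependency G W r s x - 1) else 0 := by
    intro l
    induction l with
    | nil => simp
    | cons w l ih =>
      intro P hP del bc hdel
      have hw : G.Reachable s w := (hmem w).1 (by simp [hP])
      have hww : w ∉ st.pred w := fun h => (G.loopless.irrefl w) ((hmp w w).1 h).2.1
      have hnd' := hnd
      rw [hP, List.nodup_append, List.nodup_cons] at hnd'
      have hwP : w ∉ P := fun h => hnd'.2.2 w h w List.mem_cons_self rfl
      -- Successors of w are farther from s, and the stack delivers vertices in order of decreasing
      -- distance. So all of them have been popped and δ[w] is final.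
      have hdw : del w = dependency G W r s w - 1 := by
        rw [hdel, dependency_eq_sum hW (mem_of_reachable hW hs hw) hw, sub_add_eq_add_sub]
        congr 2
        refine Finset.sum_congr (Finset.ext fun y => ?_) fun _ _ => rfl
        rw [Finset.mem_filter, Finset.mem_filter, List.mem_toFinset, hmp]
        refine ⟨fun h => ⟨hW h.2.2.1.symm, h.2.2.1, h.2.2.2.symm⟩,
          fun h => ⟨?_, hw, h.2.1, h.2.2.symm⟩⟩
        have hy : y ∈ P ++ w :: l := hP ▸ (hmem y).2 (hw.trans h.2.1.reachable)
        rw [List.mem_append] at hy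
        refine hy.resolve_right fun hy => ?_
        rw [hP, List.pairwise_append, List.pairwise_cons] at hso
        rw [List.mem_cons] at hy
        rcases hy with rfl | hy
        · exact G.loopless.irrefl _ h.2.1
        · have := hso.2.1.1 y hy
          omega
      have hacc : ∀ y, accumulate st w del y = del y + if y ∈ st.pred w then
          (numShortest G s y : ℚ) / numShortest G s w * dependency G W r s w else 0 := by
        intro y
        rw [accumulate_apply st w (hpn w) hww, hdw, hsig w hw, add_sub_cancel]
        split_ifs with hy
        · rw [hsig y ((hmp _ _).1 hy).1]
        · rfl
      have hPs : st.stack = (P ++ [w]) ++ l := by simp [hP]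
      rw [List.foldl_cons, ih (P ++ [w]) hPs]
      · rw [hacc, if_neg hww, add_zero, hdw]
        by_cases hxw : x = w
        · subst hxw
          by_cases hxs : x = s <;> simp [hxs, hnd'.2.1.1]
        · by_cases hws : w = s <;> simp [hxw, hws, Function.update_of_ne]
          grind
      · intro y
        have : (P ++ [w]).toFinset = insert w P.toFinset := by ext; simp
        rw [hacc, hdel, this, Finset.filter_insert]
        split_ifs with hy
        · rw [Finset.sum_insert (by simp [hwP])]
          ring
        · ring
  rw [backPropagate, key st.stack [] (by simp) _ bc (by simp)]
  simp only [hmem]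

end Accumulation

/-! ### The score and its computation by the algorithms -/

section Score

variable {α : Type*} {G : SimpleGraph α} {W : Finset α}

open scoped Classical in
/-- The vertices other than `x` from which `x` is reachable. -/
noncomputable def sources (G : SimpleGraph α) (W : Finset α) (x : α) : Finset α :=
  W.filter fun s => s ≠ x ∧ G.Reachable s x

theorem mem_sources {s x : α} : s ∈ sources G W x ↔ s ∈ W ∧ s ≠ x ∧ G.Reachable s x := by
  classical exact Finset.mem_filter

/-- The score of `x` in the weighted graph: the sum of the dependencies on `x` of the sources
`s ≠ x`. -/
noncomputable def score (G : SimpleGraph α) (W : Finset α) (r : α → ℚ) (x : α) : ℚ :=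
  ∑ s ∈ sources G W x, r s * (dependency G W r s x - 1)

open scoped Classical in
theorem foldl_backPropagate [DecidableEq α] (hW : ∀ ⦃x y⦄, G.Adj x y → x ∈ W) (L : Listing W G)
    (r : α → ℚ) (x : α) :
    L.order.foldl (fun bc s => backPropagate (bfs L s) s (fun _ d => r s * d)
      (fun v => r v - 1) bc) (fun _ => 0) x = score G W r x := by
  have key : ∀ l : List α, l.Nodup → (∀ s ∈ l, s ∈ W) → ∀ bc : α → ℚ,
      l.foldl (fun bc s => backPropagate (bfs L s) s (fun _ d => r s * d)
        (fun v => r v - 1) bc) bc x =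
      bc x + ∑ s ∈ l.toFinset, if s ≠ x ∧ G.Reachable s x then
        r s * (dependency G W r s x - 1) else 0 := by
    intro l
    induction l with
    | nil => simp
    | cons s l ih =>
      intro hn hl bc
      obtain ⟨hsl, hn⟩ := List.nodup_cons.1 hn
      rw [List.foldl_cons, ih hn (fun y hy => hl y (List.mem_cons_of_mem _ hy)),
        backPropagate_bfs hW L (hl s List.mem_cons_self), List.toFinset_cons,
        Finset.sum_insert (by simpa using hsl), add_assoc]
      simp only [ne_comm]
  rw [key _ L.order_nodup (fun s hs => (L.mem_order s).1 hs), score, zero_add,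
    ← Finset.sum_filter]
  refine Finset.sum_congr (Finset.ext fun s => ?_) fun _ _ => rfl
  rw [Finset.mem_filter, List.mem_toFinset, L.mem_order, mem_sources]

theorem bcReach_eq_score [DecidableEq α] (hW : ∀ ⦃x y⦄, G.Adj x y → x ∈ W) (L : Listing W G)
    (reach : α → ℕ) (x : α) : bcReach L reach x = score G W (fun v => reach v) x :=
  foldl_backPropagate hW L (fun v => reach v) x

theorem bcOrg_eq_score [DecidableEq α] (hW : ∀ ⦃x y⦄, G.Adj x y → x ∈ W) (L : Listing W G)
    (x : α) : bcOrg L x = score G W (fun _ => 1) x := by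
  rw [← foldl_backPropagate hW L, bcOrg]
  simp only [one_mul, sub_self]

/-- With unit weights, subtracting 1 removes precisely the target t = x; sources that do not reach x
contribute 0 to the betweenness. -/
theorem betweenness_eq_score [Fintype α] [DecidableEq α] (G : SimpleGraph α) (x : α) :
    betweenness G x = score G Finset.univ (fun _ => 1) x := by
  have hW : ∀ ⦃x y⦄, G.Adj x y → x ∈ Finset.univ := fun _ _ _ => Finset.mem_univ _
  rw [betweenness, score]
  symm
  refine Finset.sum_subset_zero_on_sdiff ?_ ?_ ?_
  · intro s hs
    rw [mem_sources] at hs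
    exact Finset.mem_erase.2 ⟨hs.2.1, hs.1⟩
  · intro s hs
    rw [Finset.mem_sdiff, mem_sources, Finset.mem_erase] at hs
    exact Finset.sum_eq_zero fun t _ => pairDependency_eq_zero_of_not_reachable
      fun h => hs.2 ⟨hs.1.2, hs.1.1, h⟩
  · intro s hs
    rw [mem_sources] at hs
    rw [dependency, ← Finset.add_sum_erase _ _ (Finset.mem_univ x),
      pairDependency_right hW hs.2.2]
    simp

theorem score_of_not_mem (hW : ∀ ⦃x y⦄, G.Adj x y → x ∈ W) {r : α → ℚ} {x : α} (hx : x ∉ W) :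
    score G W r x = 0 := by
  classical
  rw [score, Finset.sum_eq_zero]
  intro s hs
  rw [mem_sources] at hs
  exact absurd (mem_of_reachable hW hs.1 hs.2.2) hx

end Score

/-! ### Isomorphisms between geodesically closed subgraphs -/

section Transfer

variable {α β : Type*} {G : SimpleGraph α} {G' : SimpleGraph β} {W : Finset α} {W' : Finset β}
  {f : α → β}

/-- The set `A` contains all shortest paths between its elements. -/
def GeodesicallyClosed (G : SimpleGraph α) (A : Set α) : Prop :=
  ∀ s ∈ A, ∀ t ∈ A, ∀ v, OnGeodesic G s t v → v ∈ A

theorem GeodesicallyClosed.mem_of_adj {A : Set α} (hA : GeodesicallyClosed G A) {s t v : α}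
    (hs : s ∈ A) (ht : t ∈ A) (hvt : G.Adj v t) (hr : G.Reachable s v)
    (hd : G.dist s v + 1 = G.dist s t) : v ∈ A :=
  hA s hs t ht v ⟨hr, hvt.reachable, by rw [SimpleGraph.dist_eq_one_iff_adj.2 hvt, hd]⟩

theorem geodesicallyClosed_of_adj {A : Set α} (h : ∀ x ∈ A, ∀ y, G.Adj x y → y ∈ A) :
    GeodesicallyClosed G A := by
  intro s hs t _ v hv
  obtain ⟨p⟩ := hv.1
  clear hv
  induction p with
  | nil => exact hs
  | cons hadj _ ih => exact ih (h _ hs _ hadj)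

/-- A geodesic between elements of A stays in A, so it can be mapped edge by edge. -/
theorem GeodesicallyClosed.reachable_map {A : Set α} (hA : GeodesicallyClosed G A)
    (hf : ∀ a ∈ A, ∀ b ∈ A, G.Adj a b → G'.Adj (f a) (f b)) {s t : α} (hs : s ∈ A) (ht : t ∈ A)
    (h : G.Reachable s t) :
    G'.Reachable (f s) (f t) ∧ G'.dist (f s) (f t) ≤ G.dist s t := by
  induction hn : G.dist s t generalizing t with
  | zero =>
    rw [h.dist_eq_zero_iff] at hn
    subst hn
    simp
  | succ n ih =>
    obtain ⟨v, hvt, hv, hd⟩ := exists_adj_dist_add_one h (by rintro rfl; simp at hn)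
    have hvA := hA.mem_of_adj hs ht hvt hv hd
    obtain ⟨h1, h2⟩ := ih hvA hv (by omega)
    have hadj := hf v hvA t ht hvt
    exact ⟨h1.trans hadj.reachable, (dist_le_dist_add_one h1 hadj).trans (by omega)⟩

/-- `f` is an isomorphism from the subgraph of `G` induced by the geodesically closed set `A` onto
a geodesically closed induced subgraph of `G'`. -/
structure GeodesicIso (G : SimpleGraph α) (A : Set α) (G' : SimpleGraph β) (f : α → β) : Prop where
  injOn : Set.InjOn f A
  adj_iff : ∀ a ∈ A, ∀ b ∈ A, G'.Adj (f a) (f b) ↔ G.Adj a b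
  closed : GeodesicallyClosed G A
  closed_image : GeodesicallyClosed G' (f '' A)

namespace GeodesicIso

variable {A : Set α} (h : GeodesicIso G A G' f) {s t v : α} (hs : s ∈ A) (ht : t ∈ A)
  (hv : v ∈ A)

include h hs ht

/-- The inequality for mapped geodesics is applied to f and to its inverse on the image of A. -/
theorem reachable_iff_and_dist : (G'.Reachable (f s) (f t) ↔ G.Reachable s t) ∧
    G'.dist (f s) (f t) = G.dist s t := by
  have : Nonempty α := ⟨s⟩
  have hinv : ∀ a ∈ A, Function.invFunOn f A (f a) = a := fun a ha => h.injOn.leftInvOn_invFunOn ha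
  have h1 := fun hr => h.closed.reachable_map (fun a ha b hb => (h.adj_iff a ha b hb).2) hs ht hr
  have h2 := fun hr => h.closed_image.reachable_map (G' := G) (f := Function.invFunOn f A)
    (by
      rintro _ ⟨a, ha, rfl⟩ _ ⟨b, hb, rfl⟩ hab
      rw [hinv a ha, hinv b hb]
      exact (h.adj_iff a ha b hb).1 hab)
    (Set.mem_image_of_mem f hs) (Set.mem_image_of_mem f ht) hr
  rw [hinv s hs, hinv t ht] at h2
  by_cases hr : G.Reachable s t
  · have hr' := (h1 hr).1
    exact ⟨iff_of_true hr' hr, le_antisymm (h1 hr).2 (h2 hr').2⟩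
  · have hr' := fun hr' => hr (h2 hr').1
    refine ⟨iff_of_false hr' hr, ?_⟩
    rw [SimpleGraph.dist_eq_zero_of_not_reachable hr,
      SimpleGraph.dist_eq_zero_of_not_reachable hr']

theorem reachable_iff : G'.Reachable (f s) (f t) ↔ G.Reachable s t :=
  (h.reachable_iff_and_dist hs ht).1

theorem dist_eq : G'.dist (f s) (f t) = G.dist s t :=
  (h.reachable_iff_and_dist hs ht).2

/-- Induction on the distance, counting by the last step: by closedness on both sides, the
penultimate vertices correspond under f. -/
theorem numShortest_eq (hW : ∀ ⦃x y⦄, G.Adj x y → x ∈ W) (hW' : ∀ ⦃x y⦄, G'.Adj x y → x ∈ W') :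
    numShortest G' (f s) (f t) = numShortest G s t := by
  classical
  induction hn : G.dist s t using Nat.strong_induction_on generalizing t with
  | _ n ih =>
    by_cases hst : s = t
    · rw [hst, numShortest_self, numShortest_self]
    rw [numShortest_eq_sum' hW hst,
      numShortest_eq_sum' hW' (fun he => hst (h.injOn hs ht he))]
    by_cases hr : G.Reachable s t
    · have hmem : ∀ v, G.Adj v t → G.dist s v + 1 = G.dist s t → v ∈ A := fun v hvt hd =>
        h.closed.mem_of_adj hs ht hvt (hr.trans hvt.symm.reachable) hd
      symm
      refine Finset.sum_bij (fun v _ => f v) ?_ ?_ ?_ ?_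
      · intro v hv
        rw [Finset.mem_filter] at hv
        have hvA := hmem v hv.2.1 hv.2.2
        have hadj := (h.adj_iff v hvA t ht).2 hv.2.1
        rw [Finset.mem_filter, h.dist_eq hs hvA, h.dist_eq hs ht]
        exact ⟨hW' hadj, hadj, hv.2.2⟩
      · intro v hv v' hv' he
        rw [Finset.mem_filter] at hv hv'
        exact h.injOn (hmem v hv.2.1 hv.2.2) (hmem v' hv'.2.1 hv'.2.2) he
      · intro b hb
        rw [Finset.mem_filter] at hb
        have hr' := (h.reachable_iff hs ht).2 hr
        obtain ⟨v, hvA, rfl⟩ := h.closed_image.mem_of_adj (Set.mem_image_of_mem f hs)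
          (Set.mem_image_of_mem f ht) hb.2.1 (hr'.trans hb.2.1.symm.reachable) hb.2.2
        rw [h.dist_eq hs hvA, h.dist_eq hs ht, h.adj_iff v hvA t ht] at hb
        exact ⟨v, Finset.mem_filter.2 ⟨hW hb.2.1, hb.2⟩, rfl⟩
      · intro v hv
        rw [Finset.mem_filter] at hv
        exact (ih _ (by omega) (hmem v hv.2.1 hv.2.2) rfl).symm
    · rw [Finset.sum_eq_zero, Finset.sum_eq_zero]
      · intro v hv
        rw [Finset.mem_filter] at hv
        exact numShortest_eq_zero fun h' => hr (h'.trans hv.2.1.reachable)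
      · intro v hv
        rw [Finset.mem_filter] at hv
        exact numShortest_eq_zero fun h' =>
          hr ((h.reachable_iff hs ht).1 (h'.trans hv.2.1.reachable))

include hv in
theorem pairDependency_eq (hW : ∀ ⦃x y⦄, G.Adj x y → x ∈ W)
    (hW' : ∀ ⦃x y⦄, G'.Adj x y → x ∈ W') :
    pairDependency G' (f s) (f t) (f v) = pairDependency G s t v := by
  have hiff : OnGeodesic G' (f s) (f t) (f v) ↔ OnGeodesic G s t v := by
    rw [OnGeodesic, OnGeodesic, h.reachable_iff hs hv, h.reachable_iff hv ht, h.dist_eq hs hv,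
      h.dist_eq hv ht, h.dist_eq hs ht]
  by_cases hg : OnGeodesic G s t v
  · rw [pairDependency_of_onGeodesic hg, pairDependency_of_onGeodesic (hiff.2 hg),
      h.numShortest_eq hs hv hW hW', h.numShortest_eq hv ht hW hW', h.numShortest_eq hs ht hW hW']
  · rw [pairDependency_eq_zero hg, pairDependency_eq_zero (mt hiff.1 hg)]

end GeodesicIso

end Transfer

/-! ### Gates and vertices with a clique as neighbourhood -/

section Gates

variable {α : Type*} {G : SimpleGraph α} {W : Finset α}

/-- The set `A` can be left only through its element `u`. -/
structure IsGated (G : SimpleGraph α) (A : Set α) (u : α) : Prop where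
  mem : u ∈ A
  eq_of_adj : ∀ a ∈ A, ∀ b ∉ A, G.Adj a b → a = u

namespace IsGated

variable {A : Set α} {u : α} (h : IsGated G A u)

include h

theorem mem_support {a b : α} (ha : a ∈ A) (hb : b ∉ A) (p : G.Walk a b) : u ∈ p.support := by
  induction p with
  | nil => exact absurd ha hb
  | @cons a c b hac q ih =>
    rw [SimpleGraph.Walk.support_cons]
    by_cases hc : c ∈ A
    · exact List.mem_cons_of_mem _ (ih hc hb)
    · rw [h.eq_of_adj a ha c hc hac]
      exact List.mem_cons_self

theorem onGeodesic {a b : α} (ha : a ∈ A) (hb : b ∉ A) (hr : G.Reachable a b) :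
    OnGeodesic G a b u := by
  obtain ⟨p, hp⟩ := hr.exists_walk_length_eq_dist
  exact (onGeodesic_of_mem_support hp (h.mem_support ha hb p)).1

theorem numShortest_eq_mul {a b : α} (ha : a ∈ A) (hb : b ∉ A) (hr : G.Reachable a b) :
    numShortest G a b = numShortest G a u * numShortest G u b := by
  rw [← numShortestThrough_of_onGeodesic (h.onGeodesic ha hb hr), numShortestThrough, numShortest]
  exact Nat.card_congr (Equiv.subtypeEquivRight fun p =>
    ⟨fun hp => ⟨hp, h.mem_support ha hb p⟩, fun hp => hp.1⟩)

/-- A path entering A to reach v and leaving again passes u twice, a detour of 2 d(u,v) that a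
geodesic cannot afford. -/
theorem eq_of_onGeodesic {s t v : α} (hs : s ∉ A) (ht : t ∉ A) (hv : v ∈ A)
    (hg : OnGeodesic G s t v) : v = u := by
  have h1 := (h.onGeodesic hv hs hg.1.symm).2.2
  have h2 := h.onGeodesic hv ht hg.2.1
  have h3 := (hg.1.trans h2.1).dist_triangle_left t
  have h4 := hg.2.2
  rw [G.dist_comm (u := v) (v := s), G.dist_comm (u := u) (v := s)] at h1
  have h5 := h2.2.2
  exact h2.1.dist_eq_zero_iff.1 (by omega)

/-- The same detour argument with inside and outside exchanged: an excursion out of A would start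
and end at u. -/
theorem geodesicallyClosed : GeodesicallyClosed G A := by
  intro s hs t ht v hg
  by_contra hv
  have h1 := h.onGeodesic hs hv hg.1
  have h2 := (h.onGeodesic ht hv hg.2.1.symm).symm
  have h3 := h1.1.dist_triangle_left t
  have h4 := hg.2.2
  have h5 := h1.2.2
  have h6 := h2.2.2
  rw [G.dist_comm (u := v) (v := u)] at h6
  exact hv ((h1.2.1.dist_eq_zero_iff.1 (by omega)) ▸ h.mem)

/-- Both σ_st and σ_vt contain the factor σ_ut, which cancels in σ_sv σ_vt / σ_st. -/
theorem pairDependency_eq (hW : ∀ ⦃x y⦄, G.Adj x y → x ∈ W) {s t v : α} (hs : s ∈ A)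
    (ht : t ∉ A) (hv : v ∈ A) (hr : G.Reachable u t) :
    pairDependency G s t v = pairDependency G s u v := by
  by_cases hsv : G.Reachable s v
  swap
  · rw [pairDependency_eq_zero_of_not_reachable hsv, pairDependency_eq_zero_of_not_reachable hsv]
  by_cases hvu : G.Reachable v u
  swap
  · rw [pairDependency_eq_zero fun hg => hvu (hg.2.1.trans hr.symm),
      pairDependency_eq_zero fun hg => hvu hg.2.1]
  have hsu := hsv.trans hvu
  have g1 := h.onGeodesic hs ht (hsu.trans hr)
  have g2 := h.onGeodesic hv ht (hvu.trans hr)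
  have hiff : OnGeodesic G s t v ↔ OnGeodesic G s u v := by
    simp only [OnGeodesic, hsv, hvu, hvu.trans hr, true_and, ← g1.2.2, ← g2.2.2]
    omega
  by_cases hg : OnGeodesic G s t v
  · have p1 := numShortest_pos hW hr
    have p2 := numShortest_pos hW hsu
    rw [pairDependency_of_onGeodesic hg, pairDependency_of_onGeodesic (hiff.1 hg),
      h.numShortest_eq_mul hs ht (hsu.trans hr), h.numShortest_eq_mul hv ht (hvu.trans hr)]
    push_cast
    field_simp
  · rw [pairDependency_eq_zero hg, pairDependency_eq_zero (mt hiff.2 hg)]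

end IsGated

/-- The neighbours before and after such a vertex on a path are equal or adjacent, so the vertex can
be bypassed by a strictly shorter path. -/
theorem geodesicallyClosed_compl_of_isClique {u : α} (h : G.IsClique (G.neighborSet u)) :
    GeodesicallyClosed G {u}ᶜ := by
  rintro s hs t ht v hg rfl
  obtain ⟨a, hav, ha, had⟩ := exists_adj_dist_add_one hg.1 hs
  obtain ⟨b, hbv, hb, hbd⟩ := exists_adj_dist_add_one hg.2.1.symm ht
  have h1 := hg.2.2
  rw [G.dist_comm (u := t), G.dist_comm (u := t)] at hbd
  by_cases hab : a = b
  · subst hab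
    have := ha.dist_triangle_left t
    omega
  · have h2 := dist_le_dist_add_one ha (h hav.symm hbv.symm hab)
    have := (ha.trans (h hav.symm hbv.symm hab).reachable).dist_triangle_left t
    omega

end Gates

/-! ### Components, and cutting off everything behind a gate -/

section Components

variable {α β : Type*} [DecidableEq α] {G : SimpleGraph α} {G' : SimpleGraph β} {W A B : Finset α}
  {W' : Finset β} {f : α → β} {r : α → ℚ} {r' : β → ℚ}

/-- The disjoint sets `A` and `B` together form a component of the graph. -/
structure IsComponentSplit (G : SimpleGraph α) (W A B : Finset α) : Prop where
  disjoint : Disjoint A B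
  subset : A ∪ B ⊆ W
  reachable_iff : ∀ x ∈ A ∪ B, ∀ y, G.Reachable x y ↔ y ∈ A ∪ B

namespace IsComponentSplit

variable (h : IsComponentSplit G W A B)

include h

theorem dependency_eq {s v : α} (hs : s ∈ A ∪ B) : dependency G W r s v =
    ∑ t ∈ A, r t * pairDependency G s t v + ∑ t ∈ B, r t * pairDependency G s t v := by
  rw [dependency, ← Finset.sum_union h.disjoint]
  symm
  refine Finset.sum_subset h.subset fun t _ ht => ?_
  rw [pairDependency_eq_zero, mul_zero]
  exact fun hg => ht ((h.reachable_iff s hs t).1 (hg.1.trans hg.2.1))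

theorem sources_eq {w : α} (hw : w ∈ A ∪ B) : sources G W w = (A ∪ B).erase w := by
  ext s
  rw [mem_sources, Finset.mem_erase, ← h.reachable_iff w hw, G.reachable_comm]
  exact ⟨fun hs => ⟨hs.2.1, hs.2.2⟩,
    fun hs => ⟨h.subset ((h.reachable_iff w hw s).1 hs.2), hs.1, hs.2⟩⟩

theorem score_eq {w : α} (hw : w ∈ A) : score G W r w =
    ∑ s ∈ A.erase w, r s * (dependency G W r s w - 1) +
      ∑ s ∈ B, r s * (dependency G W r s w - 1) := by
  have hwB : w ∉ B := Finset.disjoint_left.1 h.disjoint hw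
  rw [score, h.sources_eq (Finset.mem_union_left _ hw), Finset.erase_union_distrib,
    Finset.erase_eq_of_notMem hwB, Finset.sum_union]
  exact h.disjoint.mono_left (Finset.erase_subset _ _)

end IsComponentSplit

/-- `f` maps the set `A`, which is connected in `G`, isomorphically onto a component of `G'`. -/
structure IsComponentIso (G : SimpleGraph α) (A : Finset α) (G' : SimpleGraph β) (W' : Finset β)
    (f : α → β) : Prop where
  injOn : Set.InjOn f A
  adj_iff : ∀ a ∈ A, ∀ b ∈ A, G'.Adj (f a) (f b) ↔ G.Adj a b
  closed : GeodesicallyClosed G (A : Set α)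
  reachable : ∀ a ∈ A, ∀ b ∈ A, G.Reachable a b
  exists_of_adj : ∀ a ∈ A, ∀ y, G'.Adj (f a) y → ∃ b ∈ A, f b = y
  mem : ∀ a ∈ A, f a ∈ W'

namespace IsComponentIso

variable (h : IsComponentIso G A G' W' f)

include h

omit [DecidableEq α] in
theorem geodesicIso : GeodesicIso G A G' f where
  injOn := h.injOn
  adj_iff := h.adj_iff
  closed := h.closed
  closed_image := geodesicallyClosed_of_adj (by
    rintro _ ⟨a, ha, rfl⟩ y hy
    obtain ⟨b, hb, rfl⟩ := h.exists_of_adj a ha y hy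
    exact ⟨b, hb, rfl⟩)

theorem reachable_iff [DecidableEq β] {a : α} (ha : a ∈ A) (y : β) :
    G'.Reachable (f a) y ↔ y ∈ A.image f := by
  constructor
  · rintro ⟨p⟩
    have hx : f a ∈ A.image f := Finset.mem_image_of_mem f ha
    clear ha
    generalize f a = x at p hx
    induction p with
    | nil => exact hx
    | cons hadj _ ih =>
      obtain ⟨b, hb, rfl⟩ := Finset.mem_image.1 hx
      obtain ⟨c, hc, rfl⟩ := h.exists_of_adj b hb _ hadj
      exact ih (Finset.mem_image_of_mem f hc)
  · intro hy
    obtain ⟨b, hb, rfl⟩ := Finset.mem_image.1 hy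
    exact (h.geodesicIso.reachable_iff ha hb).2 (h.reachable a ha b hb)

theorem isComponentSplit [DecidableEq β] : IsComponentSplit G' W' (A.image f) ∅ where
  disjoint := Finset.disjoint_empty_right _
  subset := by
    rw [Finset.union_empty]
    exact Finset.image_subset_iff.2 h.mem
  reachable_iff := by
    rw [Finset.union_empty]
    intro x hx y
    obtain ⟨a, ha, rfl⟩ := Finset.mem_image.1 hx
    exact h.reachable_iff ha y

theorem dependency_eq (hW : ∀ ⦃x y⦄, G.Adj x y → x ∈ W) (hW' : ∀ ⦃x y⦄, G'.Adj x y → x ∈ W')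
    {s v : α} (hs : s ∈ A) (hv : v ∈ A) :
    dependency G' W' r' (f s) (f v) = ∑ t ∈ A, r' (f t) * pairDependency G s t v := by
  classical
  rw [h.isComponentSplit.dependency_eq
    (Finset.mem_union_left _ (Finset.mem_image_of_mem f hs)), Finset.sum_empty, add_zero,
    Finset.sum_image h.injOn]
  exact Finset.sum_congr rfl fun t ht => by
    rw [h.geodesicIso.pairDependency_eq hs ht hv hW hW']

theorem score_eq {w : α} (hw : w ∈ A) : score G' W' r' (f w) =
    ∑ s ∈ A.erase w, r' (f s) * (dependency G' W' r' (f s) (f w) - 1) := by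
  classical
  rw [h.isComponentSplit.score_eq (Finset.mem_image_of_mem f hw), Finset.sum_empty, add_zero,
    ← Finset.sum_image (f := fun x => r' x * (dependency G' W' r' x (f w) - 1))
      (h.injOn.mono (by simp))]
  congr 1
  ext y
  simp only [Finset.mem_erase, Finset.mem_image]
  constructor
  · rintro ⟨hy, a, ha, rfl⟩
    exact ⟨a, ⟨fun hh => hy (hh ▸ rfl), ha⟩, rfl⟩
  · rintro ⟨a, ⟨haw, ha⟩, rfl⟩
    exact ⟨fun hh => haw (h.injOn ha hw hh), a, ha, rfl⟩

end IsComponentIso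

section Gated

variable {u : α} (hs : IsComponentSplit G W A B) (hu : IsGated G (A : Set α) u)
  (h : IsComponentIso G A G' W' f) (hW : ∀ ⦃x y⦄, G.Adj x y → x ∈ W)
  (hW' : ∀ ⦃x y⦄, G'.Adj x y → x ∈ W')
  (hr : ∀ a ∈ A, r' (f a) = r a + if a = u then ∑ b ∈ B, r b else 0)

include hs hu hW

theorem IsGated.dependency_eq {s v : α} (hsA : s ∈ A) (hv : v ∈ A) :
    dependency G W r s v = ∑ t ∈ A, r t * pairDependency G s t v +
      (∑ t ∈ B, r t) * pairDependency G s u v := by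
  rw [hs.dependency_eq (Finset.mem_union_left _ hsA), Finset.sum_mul]
  congr 1
  refine Finset.sum_congr rfl fun t ht => ?_
  rw [hu.pairDependency_eq hW hsA (fun h => Finset.disjoint_right.1 hs.disjoint ht h) hv
    ((hs.reachable_iff u (Finset.mem_union_left _ hu.mem) t).2 (Finset.mem_union_right _ ht))]

/-- Seen from v, a source in B acts as if it sat at the gate: for targets in A use the symmetry of
δ_st and the gate, while a geodesic between two vertices of B meets A at most in u. -/
theorem IsGated.dependency_eq_of_mem_right {s v : α} (hsB : s ∈ B) (hv : v ∈ A) (hne : v ≠ u) :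
    dependency G W r s v = dependency G W r u v := by
  have hsA : s ∉ (A : Set α) := Finset.disjoint_right.1 hs.disjoint hsB
  rw [hu.dependency_eq hs hW hu.mem hv, pairDependency_self hne, mul_zero, add_zero,
    hs.dependency_eq (Finset.mem_union_right _ hsB), Finset.sum_eq_zero (s := B), add_zero]
  · refine Finset.sum_congr rfl fun t ht => ?_
    rw [pairDependency_comm, hu.pairDependency_eq hW ht hsA hv, pairDependency_comm]
    exact (hs.reachable_iff u (Finset.mem_union_left _ hu.mem) s).2
      (Finset.mem_union_right _ hsB)
  · intro t ht
    rw [pairDependency_eq_zero, mul_zero]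
    exact fun hg => hne (hu.eq_of_onGeodesic hsA
      (Finset.disjoint_right.1 hs.disjoint ht : t ∉ (A : Set α)) hv hg)

/-- Every path from s into A passes u, so each target in A contributes its full weight; for targets
in B, closedness keeps the geodesics away from u. -/
theorem IsGated.dependency_gate (hB : GeodesicallyClosed G (B : Set α)) {s : α} (hsB : s ∈ B) :
    dependency G W r s u = ∑ t ∈ A, r t := by
  have huA : u ∈ A := hu.mem
  have hcomp := hs.reachable_iff u (Finset.mem_union_left _ huA)
  rw [hs.dependency_eq (Finset.mem_union_right _ hsB), Finset.sum_eq_zero (s := B), add_zero]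
  · refine Finset.sum_congr rfl fun t ht => ?_
    rw [pairDependency_comm, hu.pairDependency_eq hW ht
      (Finset.disjoint_right.1 hs.disjoint hsB : s ∉ (A : Set α)) huA
      ((hcomp s).2 (Finset.mem_union_right _ hsB)),
      pairDependency_right hW ((hcomp t).2 (Finset.mem_union_left _ ht)).symm, mul_one]
  · intro t ht
    rw [pairDependency_eq_zero, mul_zero]
    exact fun hg => Finset.disjoint_left.1 hs.disjoint huA (hB s hsB t ht u hg)

include h hW' hr

/-- The targets in B act like additional weight at the target u, and `hr` adds exactly this weight.
-/
theorem IsComponentIso.dependency_eq_of_isGated {s v : α} (hsA : s ∈ A) (hv : v ∈ A) :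
    dependency G' W' r' (f s) (f v) = dependency G W r s v := by
  rw [h.dependency_eq hW hW' hsA hv, hu.dependency_eq hs hW hsA hv]
  have : ∀ t ∈ A, r' (f t) * pairDependency G s t v = r t * pairDependency G s t v +
      if t = u then (∑ b ∈ B, r b) * pairDependency G s t v else 0 := by
    intro t ht
    rw [hr t ht]
    split_ifs <;> ring
  rw [Finset.sum_congr rfl this, Finset.sum_add_distrib, Finset.sum_ite_eq' A u,
    if_pos (show u ∈ A from hu.mem)]

/-- The score of the gate changes by the dependencies of the sources outside of `A`. -/
theorem IsComponentIso.score_gate : score G W r u =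
    score G' W' r' (f u) + ∑ s ∈ B, r s * (dependency G W r s u - 1) := by
  have huA : u ∈ A := hu.mem
  rw [h.score_eq huA, hs.score_eq huA]
  congr 1
  refine Finset.sum_congr rfl fun s hsA => ?_
  rw [Finset.mem_erase] at hsA
  rw [h.dependency_eq_of_isGated hs hu hW hW' hr hsA.2 huA, hr s hsA.2, if_neg hsA.1, add_zero]

/-- The scores of the vertices of `A` other than the gate are the same if the weight of the gate
is increased by the weights of the vertices outside of `A`. -/
theorem IsComponentIso.score_eq_of_ne {w : α} (hw : w ∈ A) (hne : w ≠ u) :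
    score G' W' r' (f w) = score G W r w := by
  have huA : u ∈ A := hu.mem
  rw [h.score_eq hw, hs.score_eq hw]
  have h1 : ∀ s ∈ A.erase w, r' (f s) * (dependency G' W' r' (f s) (f w) - 1) =
      r s * (dependency G W r s w - 1) +
        if s = u then (∑ b ∈ B, r b) * (dependency G W r s w - 1) else 0 := by
    intro s hsA
    rw [Finset.mem_erase] at hsA
    rw [h.dependency_eq_of_isGated hs hu hW hW' hr hsA.2 hw, hr s hsA.2]
    split_ifs <;> ring
  have h2 : ∀ s ∈ B, r s * (dependency G W r s w - 1) = r s * (dependency G W r u w - 1) :=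
    fun s hsB => by rw [hu.dependency_eq_of_mem_right hs hW hsB hw hne]
  -- The extra weight of the gate as a source replaces the sources in B, whose dependencies on w
  -- equal that of u.
  rw [Finset.sum_congr rfl h1, Finset.sum_add_distrib, Finset.sum_ite_eq',
    if_pos (Finset.mem_erase.2 ⟨hne.symm, huA⟩), Finset.sum_congr rfl h2, Finset.sum_mul]

end Gated

/-- An isomorphism of components that preserves the weights preserves the scores. -/
theorem IsComponentIso.score_eq_of_isComponent (hs : IsComponentSplit G W A ∅)
    (h : IsComponentIso G A G' W' f) (hW : ∀ ⦃x y⦄, G.Adj x y → x ∈ W)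
    (hW' : ∀ ⦃x y⦄, G'.Adj x y → x ∈ W') (hr : ∀ a ∈ A, r' (f a) = r a) {w : α} (hw : w ∈ A) :
    score G' W' r' (f w) = score G W r w := by
  -- No edge leaves a whole component, so any of its vertices serves as a gate, with B empty.
  have hu : IsGated G (A : Set α) w := by
    refine ⟨hw, fun a ha b hb hab => absurd ?_ hb⟩
    simpa using (hs.reachable_iff a (Finset.mem_union_left _ ha) b).1 hab.reachable
  rw [h.score_gate (r' := r') hs hu hW hW' (fun a ha => by simp [hr a ha]), Finset.sum_empty, add_zero]

end Components

theorem isGated_singleton {α : Type*} (G : SimpleGraph α) (u : α) : IsGated G {u} u :=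
  ⟨rfl, fun _ ha _ _ _ => ha⟩

/-- A component is described by the vertices that are reachable from one of its elements. -/
theorem IsComponentSplit.of_reachable {α : Type*} [DecidableEq α] {G : SimpleGraph α}
    {W A B : Finset α} (hW : ∀ ⦃x y⦄, G.Adj x y → x ∈ W) {u : α} (hu : u ∈ W)
    (hd : Disjoint A B) (h : ∀ x, x ∈ A ∪ B ↔ G.Reachable u x) : IsComponentSplit G W A B where
  disjoint := hd
  subset x hx := mem_of_reachable hW hu ((h x).1 hx)
  reachable_iff x hx y := by
    rw [h] at hx ⊢
    exact ⟨hx.trans, hx.symm.trans⟩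

/-! ### The invariant and its preservation by the operations -/

namespace State

variable {V : Type*} [DecidableEq V] (g : State V)

/-- The score of a copy in the current weighted graph. -/
noncomputable def weightedScore (x : Copy V) : ℚ :=
  score g.G g.verts (fun v => (g.reach v : ℚ)) x

/-- The compensations and the scores of all copies of `v`. -/
noncomputable def total (v : V) : ℚ :=
  ∑ x ∈ g.used with org x = v, (g.bc x + g.weightedScore x)

omit [DecidableEq V] in
theorem mem_verts_of_adj ⦃x y : Copy V⦄ (h : g.G.Adj x y) : x ∈ g.verts := g.mem_of_adj h

omit [DecidableEq V] in
theorem mem_comp {H : SimpleGraph (Copy V)} {u x : Copy V} :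
    x ∈ g.comp H u ↔ x ∈ g.verts ∧ H.Reachable u x := by
  classical exact Finset.mem_filter

theorem mem_around {u x : Copy V} (hu : u ∈ g.verts) :
    x ∈ g.around u ↔ x ≠ u ∧ g.G.Reachable u x := by
  rw [around, Finset.mem_erase, mem_comp]
  exact and_congr_right fun _ => ⟨fun h => h.2, fun h => ⟨mem_of_reachable g.mem_verts_of_adj hu h, h⟩⟩

theorem weightedScore_of_notMem {x : Copy V} (hx : x ∉ g.verts) : g.weightedScore x = 0 :=
  score_of_not_mem g.mem_verts_of_adj hx

/-- The score does not change if the component of the copy does not change. -/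
theorem weightedScore_eq_of_not_reachable (g' : State V) {u x : Copy V} (hx : x ∈ g.verts)
    (hux : ¬ g.G.Reachable u x)
    (hadj : ∀ a ∈ g.verts, ¬ g.G.Reachable u a → ∀ b, g'.G.Adj a b ↔ g.G.Adj a b)
    (hverts : ∀ a ∈ g.verts, ¬ g.G.Reachable u a → a ∈ g'.verts)
    (hreach : ∀ a ∈ g.verts, ¬ g.G.Reachable u a → g'.reach a = g.reach a) :
    g'.weightedScore x = g.weightedScore x := by
  have hmem : ∀ y, y ∈ g.comp g.G x ↔ g.G.Reachable x y := fun y => by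
    rw [mem_comp]
    exact ⟨fun h => h.2, fun h => ⟨mem_of_reachable g.mem_verts_of_adj hx h, h⟩⟩
  have hnot : ∀ a ∈ g.comp g.G x, a ∈ g.verts ∧ ¬ g.G.Reachable u a := fun a ha =>
    ⟨((g.mem_comp).1 ha).1, fun h => hux (h.trans ((hmem a).1 ha).symm)⟩
  have hs : IsComponentSplit g.G g.verts (g.comp g.G x) ∅ :=
    .of_reachable g.mem_verts_of_adj hx (Finset.disjoint_empty_right _)
      (by simpa only [Finset.union_empty] using hmem)
  have hclosed : ∀ a ∈ g.comp g.G x, ∀ b, g.G.Adj a b → b ∈ g.comp g.G x := fun a ha b hab =>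
    (hmem b).2 (((hmem a).1 ha).trans hab.reachable)
  have hiso : IsComponentIso g.G (g.comp g.G x) g'.G g'.verts id :=
    { injOn := Set.injOn_id _
      adj_iff := fun a ha b _ => hadj a (hnot a ha).1 (hnot a ha).2 b
      closed := geodesicallyClosed_of_adj hclosed
      reachable := fun a ha b hb => ((hmem a).1 ha).symm.trans ((hmem b).1 hb)
      exists_of_adj := fun a ha y hy =>
        ⟨y, hclosed a ha y ((hadj a (hnot a ha).1 (hnot a ha).2 y).1 hy), rfl⟩
      mem := fun a ha => hverts a (hnot a ha).1 (hnot a ha).2 }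
  exact hiso.score_eq_of_isComponent hs g.mem_verts_of_adj g'.mem_verts_of_adj
    (fun a ha => by simp [hreach a (hnot a ha).1 (hnot a ha).2]) ((hmem x).2 .rfl)

theorem total_eq_of_forall (g' : State V) (hused : g'.used = g.used)
    (h : ∀ x, g'.bc x + g'.weightedScore x = g.bc x + g.weightedScore x) (v : V) :
    g'.total v = g.total v := by
  rw [total, total, hused]
  exact Finset.sum_congr rfl fun x _ => h x

/-! ### Bridges -/

section Bridge

variable {g} {u v : Copy V} (h : g.IsBridge u v)

/-- By this symmetry only the side of u has to be examined. -/
theorem removeBridge_comm (huv : u ≠ v) : g.removeBridge u v = g.removeBridge v u := by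
  simp only [removeBridge, Sym2.eq_swap (a := u) (b := v), State.mk.injEq, true_and, and_true]
  constructor <;>
  · funext x
    by_cases h1 : x = u
    · subst h1
      simp [huv]
    · simp [h1]

include h

omit [DecidableEq V] in
theorem IsBridge.symm : g.IsBridge v u :=
  ⟨h.1.symm, by rw [Sym2.eq_swap]; exact h.2⟩

theorem IsBridge.mem_bridgeSide {x : Copy V} :
    x ∈ g.bridgeSide u v ↔ (g.G.deleteEdges {s(u, v)}).Reachable u x := by
  rw [bridgeSide, mem_comp]
  exact ⟨fun hx => hx.2, fun hx => ⟨mem_of_reachable g.mem_verts_of_adj (g.mem_of_adj h.1)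
    (hx.mono (SimpleGraph.deleteEdges_le _)), hx⟩⟩

theorem IsBridge.mem_bridgeSide' {x : Copy V} :
    x ∈ g.bridgeSide v u ↔ (g.G.deleteEdges {s(u, v)}).Reachable v x := by
  rw [h.symm.mem_bridgeSide, Sym2.eq_swap]

theorem IsBridge.left_mem : u ∈ g.bridgeSide u v := h.mem_bridgeSide.2 .rfl

theorem IsBridge.right_notMem : v ∉ g.bridgeSide u v := fun hv => h.2 (h.mem_bridgeSide.1 hv)

theorem IsBridge.isComponentSplit :
    IsComponentSplit g.G g.verts (g.bridgeSide u v) (g.bridgeSide v u) := by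
  refine .of_reachable g.mem_verts_of_adj (g.mem_of_adj h.1) ?_ fun x => ?_
  · rw [Finset.disjoint_left]
    intro x hx hx'
    rw [h.mem_bridgeSide] at hx
    rw [h.mem_bridgeSide'] at hx'
    exact h.2 (hx.trans hx'.symm)
  · rw [Finset.mem_union]
    constructor
    · rw [h.mem_bridgeSide, h.mem_bridgeSide']
      rintro (hx | hx)
      · exact hx.mono (SimpleGraph.deleteEdges_le _)
      · exact h.1.reachable.trans (hx.mono (SimpleGraph.deleteEdges_le _))
    · rintro ⟨p⟩
      -- Along a walk, each edge either is the bridge, whose ends lie on the two sides, or survives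
      -- the deletion and stays on one side.
      have key : ∀ a b : Copy V, ∀ _ : g.G.Walk a b, (a ∈ g.bridgeSide u v ∨ a ∈ g.bridgeSide v u) →
          (b ∈ g.bridgeSide u v ∨ b ∈ g.bridgeSide v u) := by
        intro a b p
        induction p with
        | nil => exact id
        | @cons a c b hac _ ih =>
          intro ha
          apply ih
          by_cases he : s(a, c) = s(u, v)
          · rcases Sym2.eq_iff.1 he with ⟨-, rfl⟩ | ⟨-, rfl⟩
            · exact .inr h.symm.left_mem
            · exact .inl h.left_mem
          · have hadj : (g.G.deleteEdges {s(u, v)}).Adj a c :=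
              SimpleGraph.deleteEdges_adj.2 ⟨hac, by simpa using he⟩
            rw [h.mem_bridgeSide, h.mem_bridgeSide'] at ha ⊢
            exact ha.imp (·.trans hadj.reachable) (·.trans hadj.reachable)
      exact key u x p (.inl h.left_mem)

/-- The bridge is the only edge that leaves its side. -/
theorem IsBridge.isGated : IsGated g.G (g.bridgeSide u v : Set (Copy V)) u := by
  refine ⟨h.left_mem, fun a ha b hb hab => ?_⟩
  rw [Finset.mem_coe] at ha hb
  by_cases he : s(a, b) = s(u, v)
  · rcases Sym2.eq_iff.1 he with ⟨rfl, -⟩ | ⟨rfl, -⟩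
    · rfl
    · exact absurd ha h.right_notMem
  · refine absurd ?_ hb
    rw [h.mem_bridgeSide] at ha ⊢
    exact ha.trans (SimpleGraph.deleteEdges_adj.2 ⟨hab, by simpa using he⟩ :
      (g.G.deleteEdges {s(u, v)}).Adj a b).reachable

theorem IsBridge.isComponentIso : IsComponentIso g.G (g.bridgeSide u v)
    (g.removeBridge u v).G (g.removeBridge u v).verts id where
  injOn := Set.injOn_id _
  adj_iff a ha b hb := by
    simp only [removeBridge, SimpleGraph.deleteEdges_adj, id, Set.mem_singleton_iff,
      and_iff_left_iff_imp]
    rintro - he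
    rcases Sym2.eq_iff.1 he with ⟨-, rfl⟩ | ⟨rfl, -⟩
    · exact h.right_notMem hb
    · exact h.right_notMem ha
  closed := h.isGated.geodesicallyClosed
  reachable a ha b hb := (h.isComponentSplit.reachable_iff a (Finset.mem_union_left _ ha) b).2
    (Finset.mem_union_left _ hb)
  exists_of_adj a ha y hy := by
    rw [h.mem_bridgeSide] at ha
    exact ⟨y, h.mem_bridgeSide.2 (ha.trans hy.reachable), rfl⟩
  mem a ha := h.isComponentSplit.subset (Finset.mem_union_left _ ha)

theorem IsBridge.removeBridge_eq_of_mem {x : Copy V} (hx : x ∈ g.bridgeSide u v) :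
    (g.removeBridge u v).bc x + (g.removeBridge u v).weightedScore x =
      g.bc x + g.weightedScore x := by
  have hxv : x ≠ v := fun hxv => h.right_notMem (hxv ▸ hx)
  have hr : ∀ a ∈ g.bridgeSide u v, ((g.removeBridge u v).reach (id a) : ℚ) =
      (g.reach a : ℚ) + if a = u then ∑ b ∈ g.bridgeSide v u, (g.reach b : ℚ) else 0 := by
    intro a ha
    have hav : a ≠ v := fun hav => h.right_notMem (hav ▸ ha)
    simp only [removeBridge, id, hav, if_false]
    split_ifs with hau
    · subst hau
      push_cast
      rfl
    · rw [add_zero]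
  by_cases hxu : x = u
  · subst hxu
    have h1 := h.isComponentIso.score_gate h.isComponentSplit h.isGated g.mem_verts_of_adj
      (g.removeBridge x v).mem_verts_of_adj (r := fun v => (g.reach v : ℚ))
      (r' := fun y => ((g.removeBridge x v).reach y : ℚ)) hr
    -- The far side is itself gated, hence geodesically closed, so all its sources have the same
    -- dependency on x; their sum is the compensation for the bridge.
    have h2 : ∀ s ∈ g.bridgeSide v x, (g.reach s : ℚ) *
        (dependency g.G g.verts (fun v => (g.reach v : ℚ)) s x - 1) =
        (g.reach s : ℚ) * (g.reachSum (g.bridgeSide x v) - 1) := fun s hs => by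
      rw [h.isGated.dependency_gate h.isComponentSplit g.mem_verts_of_adj
        h.symm.isGated.geodesicallyClosed hs, reachSum]
    rw [Finset.sum_congr rfl h2, ← Finset.sum_mul] at h1
    rw [weightedScore, weightedScore, h1]
    simp only [removeBridge, if_true, id, reachSum]
    ring
  · have h1 := h.isComponentIso.score_eq_of_ne h.isComponentSplit h.isGated g.mem_verts_of_adj
      (g.removeBridge u v).mem_verts_of_adj (r := fun v => (g.reach v : ℚ))
      (r' := fun y => ((g.removeBridge u v).reach y : ℚ)) hr hx hxu
    rw [weightedScore, weightedScore, ← h1]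
    simp [removeBridge, hxu, hxv]

theorem IsBridge.removeBridge_eq (x : Copy V) :
    (g.removeBridge u v).bc x + (g.removeBridge u v).weightedScore x =
      g.bc x + g.weightedScore x := by
  by_cases hxA : x ∈ g.bridgeSide u v
  · exact h.removeBridge_eq_of_mem hxA
  by_cases hxB : x ∈ g.bridgeSide v u
  · rw [removeBridge_comm h.1.ne]
    exact h.symm.removeBridge_eq_of_mem hxB
  have huA := Finset.mem_union_left (g.bridgeSide v u) h.left_mem
  have hne : ∀ a, ¬ g.G.Reachable u a → a ≠ u ∧ a ≠ v := fun a ha =>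
    ⟨fun hau => ha (hau ▸ .rfl), fun hav => ha (hav ▸ h.1.reachable)⟩
  have hux : ¬ g.G.Reachable u x := fun hr => by
    rw [h.isComponentSplit.reachable_iff u huA, Finset.mem_union] at hr
    tauto
  have hbc : (g.removeBridge u v).bc x = g.bc x := by
    simp [removeBridge, hne x hux]
  rw [hbc]
  by_cases hx : x ∈ g.verts
  · rw [g.weightedScore_eq_of_not_reachable (g.removeBridge u v) hx hux]
    · intro a _ ha b
      simp only [removeBridge, SimpleGraph.deleteEdges_adj, Set.mem_singleton_iff,
        and_iff_left_iff_imp]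
      intro _ he
      rcases Sym2.eq_iff.1 he with ⟨rfl, -⟩ | ⟨rfl, -⟩
      · exact (hne _ ha).1 rfl
      · exact (hne _ ha).2 rfl
    · exact fun a ha _ => ha
    · intro a _ ha
      simp [removeBridge, hne a ha]
  · rw [weightedScore_of_notMem _ hx, weightedScore_of_notMem _ (show x ∉ (g.removeBridge u v).verts from hx)]

end Bridge

/-! ### Side vertices and degree-1 vertices -/

section Side

variable {g} {u : Copy V}

theorem isComponentSplit_around (hu : u ∈ g.verts) :
    IsComponentSplit g.G g.verts (g.around u) {u} := by
  refine .of_reachable g.mem_verts_of_adj hu (by simp [around]) fun x => ?_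
  rw [Finset.mem_union, Finset.mem_singleton, mem_around g hu]
  by_cases hx : x = u
  · simp [hx]
  · simp [hx]

theorem isComponentSplit_singleton (hu : u ∈ g.verts) :
    IsComponentSplit g.G g.verts {u} (g.around u) where
  disjoint := (isComponentSplit_around hu).disjoint.symm
  subset := by
    rw [Finset.union_comm]
    exact (isComponentSplit_around hu).subset
  reachable_iff := by
    rw [Finset.union_comm]
    exact (isComponentSplit_around hu).reachable_iff

omit [DecidableEq V] in
theorem IsDegreeOne.isSide {v : Copy V} (h : g.IsDegreeOne u v) : g.IsSide u := by
  have huv : g.G.Adj u v := by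
    rw [← SimpleGraph.mem_neighborSet, h]
    rfl
  refine ⟨g.mem_of_adj huv, ?_⟩
  rw [h]
  exact SimpleGraph.isClique_singleton v

variable (h : g.IsSide u)

include h

theorem IsSide.geodesicallyClosed : GeodesicallyClosed g.G (g.around u : Set (Copy V)) := by
  intro s hs t ht v hv
  rw [Finset.mem_coe, mem_around g h.1] at *
  exact ⟨geodesicallyClosed_compl_of_isClique h.2 s hs.1 t ht.1 v hv, hs.2.trans hv.1⟩

/-- The other vertices stay connected after the removal: no geodesic between them uses u. -/
theorem IsSide.isComponentIso : IsComponentIso g.G (g.around u) (g.G.deleteIncidenceSet u)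
    (g.verts.erase u) id where
  injOn := Set.injOn_id _
  adj_iff a ha b hb := by
    rw [mem_around g h.1] at ha hb
    simp [SimpleGraph.deleteIncidenceSet_adj, ha.1, hb.1]
  closed := h.geodesicallyClosed
  reachable a ha b hb := by
    rw [mem_around g h.1] at ha hb
    exact ha.2.symm.trans hb.2
  exists_of_adj a ha y hy := by
    simp only [id, SimpleGraph.deleteIncidenceSet_adj] at hy
    rw [mem_around g h.1] at ha
    exact ⟨y, (mem_around g h.1).2 ⟨hy.2.2, ha.2.trans hy.1.reachable⟩, rfl⟩
  mem a ha := by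
    have := (isComponentSplit_around h.1).subset (Finset.mem_union_left _ ha)
    exact Finset.mem_erase.2 ⟨((mem_around g h.1).1 ha).1, this⟩

/-- With A = {u}, the only target that counts at u is u itself, so each source s contributes r(s)
(r(u) - 1). -/
theorem IsSide.weightedScore_eq :
    g.weightedScore u = ((g.reach u : ℚ) - 1) * g.reachSum (g.around u) := by
  have hs := isComponentSplit_singleton h.1
  have hu : IsGated g.G (({u} : Finset (Copy V)) : Set (Copy V)) u := by
    simpa using isGated_singleton g.G u
  rw [weightedScore, hs.score_eq (Finset.mem_singleton_self u), Finset.erase_singleton,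
    Finset.sum_empty, zero_add, reachSum, Finset.mul_sum]
  refine Finset.sum_congr rfl fun s hsA => ?_
  rw [hu.dependency_gate hs g.mem_verts_of_adj h.geodesicallyClosed hsA, Finset.sum_singleton,
    mul_comm]

omit [DecidableEq V] h in
theorem deleteIncidenceSet_adj_of_not_reachable {a b : Copy V} (ha : ¬ g.G.Reachable u a) :
    (g.G.deleteIncidenceSet u).Adj a b ↔ g.G.Adj a b := by
  rw [SimpleGraph.deleteIncidenceSet_adj, and_iff_left_iff_imp]
  intro hab
  constructor
  · rintro rfl
    exact ha .rfl
  · rintro rfl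
    exact ha hab.symm.reachable

omit h in
-- A degree-1 vertex is a side vertex, which settles the score of u. For the others, v is a gate of
-- the rest of the component, with u alone behind it.
theorem IsDegreeOne.removeDegreeOne_eq {v : Copy V} (h : g.IsDegreeOne u v) (x : Copy V) :
    (g.removeDegreeOne u v).bc x + (g.removeDegreeOne u v).weightedScore x =
      g.bc x + g.weightedScore x := by
  have hside := h.isSide
  have huv : g.G.Adj u v := by
    rw [← SimpleGraph.mem_neighborSet, h]
    rfl
  by_cases hxu : x = u
  · subst hxu
    rw [weightedScore_of_notMem _ (by simp [removeDegreeOne]), hside.weightedScore_eq]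
    simp [removeDegreeOne]
  have hs := isComponentSplit_around hside.1
  have hvA : v ∈ g.around u := (mem_around g hside.1).2 ⟨huv.ne', huv.reachable⟩
  have hv : IsGated g.G (g.around u : Set (Copy V)) v := by
    refine ⟨hvA, fun a ha b hb hab => ?_⟩
    rw [Finset.mem_coe, mem_around g hside.1] at ha hb
    by_cases hbu : b = u
    · subst hbu
      have : a ∈ g.G.neighborSet b := hab.symm
      rw [h] at this
      exact this
    · exact absurd ⟨hbu, ha.2.trans hab.reachable⟩ hb
  have hr : ∀ a ∈ g.around u, ((g.removeDegreeOne u v).reach (id a) : ℚ) =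
      (g.reach a : ℚ) + if a = v then ∑ b ∈ {u}, (g.reach b : ℚ) else 0 := by
    intro a _
    simp only [removeDegreeOne, id, Finset.sum_singleton]
    split_ifs with hav
    · subst hav
      push_cast
      rfl
    · rw [add_zero]
  by_cases hxv : x = v
  · subst hxv
    have h1 := hside.isComponentIso.score_gate hs hv g.mem_verts_of_adj
      (g.removeDegreeOne u x).mem_verts_of_adj (r := fun v => (g.reach v : ℚ))
      (r' := fun y => ((g.removeDegreeOne u x).reach y : ℚ)) hr
    rw [Finset.sum_singleton, hv.dependency_gate hs g.mem_verts_of_adj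
      (by simpa using (isGated_singleton g.G u).geodesicallyClosed)
      (Finset.mem_singleton_self u)] at h1
    rw [weightedScore, weightedScore, h1]
    simp only [removeDegreeOne, if_true, id, reachSum, hxu, if_false]
    ring
  have hbc : (g.removeDegreeOne u v).bc x = g.bc x := by
    simp [removeDegreeOne, hxu, hxv]
  rw [hbc]
  by_cases hx : x ∈ g.verts
  · by_cases hux : g.G.Reachable u x
    · have h1 := hside.isComponentIso.score_eq_of_ne hs hv g.mem_verts_of_adj
        (g.removeDegreeOne u v).mem_verts_of_adj (r := fun v => (g.reach v : ℚ))
        (r' := fun y => ((g.removeDegreeOne u v).reach y : ℚ)) hr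
        ((mem_around g hside.1).2 ⟨hxu, hux⟩) hxv
      rw [weightedScore, weightedScore, ← h1]
      rfl
    · rw [g.weightedScore_eq_of_not_reachable (g.removeDegreeOne u v) hx hux]
      · exact fun a _ ha b => deleteIncidenceSet_adj_of_not_reachable ha
      · exact fun a ha hua => Finset.mem_erase.2 ⟨fun hau => hua (hau ▸ .rfl), ha⟩
      · intro a _ ha
        have : a ≠ v := fun hav => ha (hav ▸ huv.reachable)
        simp [removeDegreeOne, this]
  · rw [weightedScore_of_notMem _ hx,
      weightedScore_of_notMem _ (fun hx' => hx (Finset.mem_of_mem_erase hx'))]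

omit h in
open scoped Classical in
theorem bfsSide_apply (L : Listing g.verts g.G) (hu : u ∈ g.verts) (bc : Copy V → ℚ)
    (x : Copy V) : bfsSide L u g.reach bc x = bc x + if x ≠ u ∧ g.G.Reachable u x then
      (g.reach u : ℚ) * (dependency g.G g.verts (fun v => (g.reach v : ℚ)) u x - 1) +
      (g.reach u : ℚ) * (dependency g.G g.verts (fun v => (g.reach v : ℚ)) u x - 1 -
        ((g.reach x : ℚ) - 1)) else 0 :=
  backPropagate_bfs g.mem_verts_of_adj L hu
    (fun w d => (g.reach u : ℚ) * d + (g.reach u : ℚ) * (d - ((g.reach w : ℚ) - 1)))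
    (fun v => (g.reach v : ℚ)) bc x

/-- The two summands are the lost pairs with u as source and as target. For the latter, symmetry
turns Σ_{s ≠ x} r(s) r(u) δ_su(x) into r(u) (D(u,x) - r(x)), read off from the search from u. -/
theorem IsSide.weightedScore_removeSide (L : Listing g.verts g.G) {x : Copy V}
    (hx : x ∈ g.around u) :
    g.weightedScore x = (g.removeSide L u).weightedScore x +
      ((g.reach u : ℚ) * (dependency g.G g.verts (fun v => (g.reach v : ℚ)) u x - 1) +
      (g.reach u : ℚ) * (dependency g.G g.verts (fun v => (g.reach v : ℚ)) u x - 1 -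
        ((g.reach x : ℚ) - 1))) := by
  have hs := isComponentSplit_around h.1
  have hxu := (mem_around g h.1).1 hx
  have huM : u ∈ g.around u ∪ {u} := by simp
  have hdep : ∀ s ∈ g.around u, dependency g.G g.verts (fun v => (g.reach v : ℚ)) s x =
      dependency (g.G.deleteIncidenceSet u) (g.verts.erase u) (fun v => (g.reach v : ℚ)) s x +
        (g.reach u : ℚ) * pairDependency g.G u s x := by
    intro s hsA
    have h1 := h.isComponentIso.dependency_eq g.mem_verts_of_adj
      (g.removeSide L u).mem_verts_of_adj (r' := fun v => (g.reach v : ℚ)) hsA hx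
    simp only [id] at h1
    rw [h1, hs.dependency_eq (Finset.mem_union_left _ hsA), Finset.sum_singleton,
      pairDependency_comm s u]
  have hdu : dependency g.G g.verts (fun v => (g.reach v : ℚ)) u x =
      (g.reach x : ℚ) +
        ∑ s ∈ (g.around u).erase x, (g.reach s : ℚ) * pairDependency g.G u s x := by
    rw [hs.dependency_eq huM, Finset.sum_singleton, pairDependency_self hxu.1,
      ← Finset.add_sum_erase _ _ hx, pairDependency_right g.mem_verts_of_adj hxu.2]
    ring
  have hG' := h.isComponentIso.score_eq (r' := fun v => (g.reach v : ℚ)) hx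
  simp only [id] at hG'
  change g.weightedScore x = score (g.G.deleteIncidenceSet u) (g.verts.erase u)
    (fun v => (g.reach v : ℚ)) x + _
  rw [hG', weightedScore, hs.score_eq hx, Finset.sum_singleton]
  have h2 : ∀ s ∈ (g.around u).erase x, (g.reach s : ℚ) *
      (dependency g.G g.verts (fun v => (g.reach v : ℚ)) s x - 1) =
      (g.reach s : ℚ) * (dependency (g.G.deleteIncidenceSet u) (g.verts.erase u)
        (fun v => (g.reach v : ℚ)) s x - 1) +
      (g.reach u : ℚ) * ((g.reach s : ℚ) * pairDependency g.G u s x) := by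
    intro s hsA
    rw [hdep s (Finset.mem_of_mem_erase hsA)]
    ring
  rw [Finset.sum_congr rfl h2, Finset.sum_add_distrib, ← Finset.mul_sum, hdu]
  ring

theorem IsSide.removeSide_eq (L : Listing g.verts g.G) (x : Copy V) :
    (g.removeSide L u).bc x + (g.removeSide L u).weightedScore x =
      g.bc x + g.weightedScore x := by
  classical
  by_cases hxu : x = u
  · subst hxu
    rw [weightedScore_of_notMem _ (by simp [removeSide]), h.weightedScore_eq]
    simp [removeSide, bfsSide_apply L h.1]
  by_cases hux : g.G.Reachable u x
  · rw [h.weightedScore_removeSide L ((mem_around g h.1).2 ⟨hxu, hux⟩)]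
    simp only [removeSide, hxu, if_false, bfsSide_apply L h.1, ne_eq, not_false_eq_true, hux,
      true_and, if_true]
    ring
  · have hbc : (g.removeSide L u).bc x = g.bc x := by
      simp [removeSide, bfsSide_apply L h.1, hxu, hux]
    rw [hbc]
    by_cases hx : x ∈ g.verts
    · rw [g.weightedScore_eq_of_not_reachable (g.removeSide L u) hx hux]
      · exact fun a _ ha b => deleteIncidenceSet_adj_of_not_reachable ha
      · exact fun a ha hua => Finset.mem_erase.2 ⟨fun hau => hua (hau ▸ .rfl), ha⟩
      · exact fun a _ _ => rfl
    · rw [weightedScore_of_notMem _ hx,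
        weightedScore_of_notMem _ (fun hx' => hx (Finset.mem_of_mem_erase hx'))]

end Side

end State

namespace State

variable {V : Type*} [DecidableEq V]

/-! ### Articulation vertices -/

section Shatter

variable {g : State V} {u : Copy V} {κ : Copy V → Copy V}

theorem mem_verts_of_mem_around (hu : u ∈ g.verts) {x : Copy V} (hx : x ∈ g.around u) :
    x ∈ g.verts :=
  (isComponentSplit_around hu).subset (Finset.mem_union_left _ hx)

variable (hu : u ∈ g.verts) (h : g.LocalCopies u κ)

include hu in
theorem mem_around_of_adj {x : Copy V} (hx : g.G.Adj u x) : x ∈ g.around u :=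
  (mem_around g hu).2 ⟨hx.ne', hx.reachable⟩

include h

theorem LocalCopies.notMem_verts {x : Copy V} (hx : x ∈ g.around u) : κ x ∉ g.verts :=
  fun hx' => h.fresh x hx (g.verts_subset hx')

include hu

theorem LocalCopies.shatter_adj {a b : Copy V} (ha : a ∈ g.verts) (hb : b ∈ g.verts) :
    (g.shatter u κ).G.Adj a b ↔ g.G.Adj a b ∧ a ≠ u ∧ b ≠ u := by
  simp only [shatter, SimpleGraph.fromRel_adj, SimpleGraph.deleteIncidenceSet_adj]
  constructor
  · rintro ⟨-, (h1 | ⟨h1, rfl⟩) | (h1 | ⟨h1, rfl⟩)⟩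
    · exact h1
    · exact absurd ha (h.notMem_verts (mem_around_of_adj hu h1))
    · exact ⟨h1.1.symm, h1.2.2, h1.2.1⟩
    · exact absurd hb (h.notMem_verts (mem_around_of_adj hu h1))
  · exact fun h1 => ⟨h1.1.ne, .inl (.inl h1)⟩

omit hu in
theorem LocalCopies.shatter_adj_copy {x y : Copy V} (hx : x ∈ g.around u) :
    (g.shatter u κ).G.Adj (κ x) y ↔ g.G.Adj u y ∧ κ x = κ y := by
  have hxv := h.notMem_verts hx
  simp only [shatter, SimpleGraph.fromRel_adj, SimpleGraph.deleteIncidenceSet_adj]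
  constructor
  · rintro ⟨-, (h1 | h1) | (h1 | h1)⟩
    · exact absurd (g.mem_of_adj h1.1) hxv
    · exact h1
    · exact absurd (g.mem_of_adj h1.1.symm) hxv
    · exact absurd (g.mem_of_adj h1.1.symm) hxv
  · exact fun h1 => ⟨fun he => hxv (he ▸ g.mem_of_adj h1.1.symm), .inl (.inr h1)⟩

omit hu in
theorem LocalCopies.eq_of_adj {x y : Copy V} (hx : x ∈ g.around u) (hy : y ∈ g.around u)
    (hxy : g.G.Adj x y) : κ x = κ y :=
  (h.eq_iff x hx y hy).2 (SimpleGraph.deleteIncidenceSet_adj.2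
    ⟨hxy, (Finset.mem_erase.1 hx).1, (Finset.mem_erase.1 hy).1⟩ :
    (g.G.deleteIncidenceSet u).Adj x y).reachable

omit h hu in
/-- The vertices other than `u` in the component of `x` after the removal of `u`. -/
noncomputable def branch (g : State V) (u : Copy V) (κ : Copy V → Copy V) (x : Copy V) :
    Finset (Copy V) :=
  (g.around u).filter fun y => κ y = κ x

omit h hu in
theorem mem_branch {x y : Copy V} : y ∈ branch g u κ x ↔ y ∈ g.around u ∧ κ y = κ x :=
  Finset.mem_filter

omit h hu in
theorem notMem_branch {x : Copy V} : u ∉ branch g u κ x := by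
  simp [branch, around]

omit h in
theorem isComponentSplit_branch (x : Copy V) : IsComponentSplit g.G g.verts
    (insert u (branch g u κ x)) (g.around u \ branch g u κ x) := by
  refine .of_reachable g.mem_verts_of_adj hu ?_ fun y => ?_
  · rw [Finset.disjoint_insert_left]
    exact ⟨by simp [around], Finset.disjoint_sdiff⟩
  · rw [Finset.insert_union, Finset.union_sdiff_of_subset (fun z hz => (mem_branch.1 hz).1),
      Finset.mem_insert, mem_around g hu]
    by_cases hy : y = u
    · simp [hy]
    · simp [hy]

theorem LocalCopies.mem_branch_of_adj {x a b : Copy V} (ha : a ∈ branch g u κ x)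
    (hb : b ≠ u) (hab : g.G.Adj a b) : b ∈ branch g u κ x := by
  rw [mem_branch] at ha ⊢
  have hbu : b ∈ g.around u :=
    (mem_around g hu).2 ⟨hb, ((mem_around g hu).1 ha.1).2.trans hab.reachable⟩
  exact ⟨hbu, (h.eq_of_adj ha.1 hbu hab).symm.trans ha.2⟩

theorem LocalCopies.isGated_branch (x : Copy V) :
    IsGated g.G (insert u (branch g u κ x) : Finset (Copy V)) u := by
  refine ⟨Finset.mem_insert_self _ _, fun a ha b hb hab => ?_⟩
  rw [Finset.mem_coe, Finset.mem_insert] at ha hb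
  rw [not_or] at hb
  by_contra hau
  exact hb.2 (h.mem_branch_of_adj hu (ha.resolve_left hau) hb.1 hab)

/-- The branch of x together with u becomes a component of the new graph in which the local copy
takes the place of u; hence the map that moves only u. -/
theorem LocalCopies.isComponentIso_branch {x : Copy V} (hx : x ∈ g.around u) :
    IsComponentIso g.G (insert u (branch g u κ x)) (g.shatter u κ).G (g.shatter u κ).verts
      (Function.update id u (κ x)) := by
  have hfu : Function.update id u (κ x) u = κ x := Function.update_self ..
  have hf : ∀ a ∈ branch g u κ x, Function.update id u (κ x) a = a := fun a ha =>
    Function.update_of_ne (fun hau => notMem_branch (hau ▸ ha)) _ _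
  have hv : ∀ a ∈ branch g u κ x, a ∈ g.verts ∧ a ≠ u := fun a ha =>
    ⟨mem_verts_of_mem_around hu (mem_branch.1 ha).1, fun hau => notMem_branch (hau ▸ ha)⟩
  have hκ : ∀ a ∈ branch g u κ x, κ x ≠ a := fun a ha he =>
    h.notMem_verts hx (he ▸ (hv a ha).1)
  have hadj : ∀ a ∈ branch g u κ x, (g.shatter u κ).G.Adj (κ x) a ↔ g.G.Adj u a := fun a ha => by
    rw [h.shatter_adj_copy hx, and_iff_left (mem_branch.1 ha).2.symm]
  constructor
  · intro a ha b hb hab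
    rw [Finset.mem_coe, Finset.mem_insert] at ha hb
    rcases ha with rfl | ha <;> rcases hb with rfl | hb
    · rfl
    · rw [hfu, hf b hb] at hab
      exact absurd hab (hκ b hb)
    · rw [hfu, hf a ha] at hab
      exact absurd hab.symm (hκ a ha)
    · rwa [hf a ha, hf b hb] at hab
  · intro a ha b hb
    rw [Finset.mem_insert] at ha hb
    rcases ha with rfl | ha <;> rcases hb with rfl | hb
    · simp
    · rw [hfu, hf b hb, hadj b hb]
    · rw [hfu, hf a ha, SimpleGraph.adj_comm, hadj a ha, SimpleGraph.adj_comm]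
    · rw [hf a ha, hf b hb, h.shatter_adj hu (hv a ha).1 (hv b hb).1,
        and_iff_left ⟨(hv a ha).2, (hv b hb).2⟩]
  · exact (h.isGated_branch hu x).geodesicallyClosed
  · intro a ha b hb
    exact ((isComponentSplit_branch hu x).reachable_iff a (Finset.mem_union_left _ ha) b).2
      (Finset.mem_union_left _ hb)
  · intro a ha y hy
    rw [Finset.mem_insert] at ha
    rcases ha with rfl | ha
    · rw [hfu, h.shatter_adj_copy hx] at hy
      have hyb : y ∈ branch g a κ x := mem_branch.2 ⟨mem_around_of_adj hu hy.1, hy.2.symm⟩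
      exact ⟨y, Finset.mem_insert_of_mem hyb, hf y hyb⟩
    · rw [hf a ha] at hy
      have hy' : y ∈ g.verts.erase u ∪ (g.around u).image κ := (g.shatter u κ).mem_of_adj hy.symm
      rw [Finset.mem_union] at hy'
      rcases hy' with hy' | hy'
      · rw [Finset.mem_erase] at hy'
        rw [h.shatter_adj hu (hv a ha).1 hy'.2] at hy
        have hyb := h.mem_branch_of_adj hu ha hy'.1 hy.1
        exact ⟨y, Finset.mem_insert_of_mem hyb, hf y hyb⟩
      · obtain ⟨z, hz, rfl⟩ := Finset.mem_image.1 hy'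
        rw [SimpleGraph.adj_comm, h.shatter_adj_copy hz] at hy
        exact ⟨u, Finset.mem_insert_self _ _, by rw [hfu, hy.2, (mem_branch.1 ha).2]⟩
  · intro a ha
    change _ ∈ g.verts.erase u ∪ (g.around u).image κ
    rw [Finset.mem_union]
    rw [Finset.mem_insert] at ha
    rcases ha with rfl | ha
    · rw [hfu]
      exact .inr (Finset.mem_image_of_mem κ hx)
    · rw [hf a ha]
      exact .inl (Finset.mem_erase.2 ⟨(hv a ha).2, (hv a ha).1⟩)

omit hu in
theorem LocalCopies.reach_of_mem_used {a : Copy V} (ha : a ∈ g.used) :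
    (g.shatter u κ).reach a = g.reach a := by
  refine if_neg fun ha' => ?_
  obtain ⟨x, hx, rfl⟩ := Finset.mem_image.1 ha'
  exact h.fresh x hx ha

/-- The sum over C \ C_i includes u, so it is r(u) plus the weight of the other branches: the weight
that the gate principle demands. -/
theorem LocalCopies.reach_branch {x : Copy V} (hx : x ∈ g.around u) :
    ∀ a ∈ insert u (branch g u κ x),
      ((g.shatter u κ).reach (Function.update id u (κ x) a) : ℚ) =
      (g.reach a : ℚ) + if a = u then ∑ b ∈ g.around u \ branch g u κ x, (g.reach b : ℚ) else 0 := by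
  intro a ha
  split_ifs with hau
  · subst hau
    have hcomp : g.comp g.G a \ branch g a κ x = insert a (g.around a \ branch g a κ x) := by
      have : g.comp g.G a = insert a (g.around a) :=
        (Finset.insert_erase ((mem_comp g).2 ⟨hu, .rfl⟩)).symm
      rw [this, Finset.insert_sdiff_of_notMem _ notMem_branch]
    rw [Function.update_self]
    change ((if κ x ∈ (g.around a).image κ then
      ∑ w ∈ g.comp g.G a \ branch g a κ x, g.reach w else g.reach (κ x) : ℕ) : ℚ) = _
    rw [if_pos (Finset.mem_image_of_mem κ hx), hcomp, Finset.sum_insert (by simp [around])]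
    push_cast
    rfl
  · rw [Function.update_of_ne hau, add_zero, id, h.reach_of_mem_used]
    exact g.verts_subset ((isComponentSplit_branch hu x).subset (Finset.mem_union_left _ ha))

theorem LocalCopies.weightedScore_of_mem_around {x : Copy V} (hx : x ∈ g.around u) :
    (g.shatter u κ).weightedScore x = g.weightedScore x := by
  have hxu : x ≠ u := (Finset.mem_erase.1 hx).1
  have h1 := (h.isComponentIso_branch hu hx).score_eq_of_ne (isComponentSplit_branch hu x)
    (h.isGated_branch hu x) g.mem_verts_of_adj (g.shatter u κ).mem_verts_of_adj
    (r := fun v => (g.reach v : ℚ)) (r' := fun v => ((g.shatter u κ).reach v : ℚ))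
    (h.reach_branch hu hx) (Finset.mem_insert_of_mem (mem_branch.2 ⟨hx, rfl⟩)) hxu
  rwa [Function.update_of_ne hxu] at h1

/-- The scores of the local copies of `u` add up to the score of `u`. -/
theorem LocalCopies.sum_weightedScore :
    ∑ y ∈ (g.around u).image κ, (g.shatter u κ).weightedScore y = g.weightedScore u := by
  have hs := isComponentSplit_singleton hu
  rw [weightedScore, hs.score_eq (Finset.mem_singleton_self u), Finset.erase_singleton,
    Finset.sum_empty, zero_add]
  -- The fibres of κ are the branches, which partition the sources of u; each local copy collects
  -- the sources of its own branch, with unchanged dependencies and weights.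
  refine Finset.sum_image' _ fun x hx => ?_
  have hiso := h.isComponentIso_branch hu hx
  have h1 := hiso.score_eq (r' := fun v => ((g.shatter u κ).reach v : ℚ))
    (Finset.mem_insert_self u _)
  rw [Function.update_self, Finset.erase_insert notMem_branch] at h1
  rw [weightedScore, h1]
  refine Finset.sum_congr rfl fun s hsb => ?_
  have hsu : s ≠ u := fun hsu => notMem_branch (hsu ▸ hsb)
  have hsA := Finset.mem_insert_of_mem (a := s) (b := u) hsb
  have h2 := hiso.dependency_eq_of_isGated (isComponentSplit_branch hu x)
    (h.isGated_branch hu x) g.mem_verts_of_adj (g.shatter u κ).mem_verts_of_adj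
    (r := fun v => (g.reach v : ℚ)) (r' := fun v => ((g.shatter u κ).reach v : ℚ))
    (h.reach_branch hu hx) hsA (Finset.mem_insert_self u _)
  have h3 := h.reach_branch hu hx s hsA
  rw [if_neg hsu, add_zero] at h3
  rw [Function.update_self] at h2
  rw [h2, h3]

theorem LocalCopies.weightedScore_of_mem_used {x : Copy V} (hx : x ∈ g.used) (hxu : x ≠ u) :
    (g.shatter u κ).weightedScore x = g.weightedScore x := by
  by_cases hxv : x ∈ g.verts
  · by_cases hux : g.G.Reachable u x
    · exact h.weightedScore_of_mem_around hu ((mem_around g hu).2 ⟨hxu, hux⟩)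
    · refine g.weightedScore_eq_of_not_reachable (g.shatter u κ) hxv hux ?_ ?_ ?_
      · intro a ha hua b
        have hau : a ≠ u := fun hau => hua (hau ▸ .rfl)
        by_cases hb : b ∈ g.verts
        · rw [h.shatter_adj hu ha hb, and_iff_left_iff_imp]
          exact fun hab => ⟨hau, fun hbu => hua (hbu ▸ hab.symm.reachable)⟩
        · refine iff_of_false (fun hab => ?_) fun hab => hb (g.mem_of_adj hab.symm)
          have hb' : b ∈ g.verts.erase u ∪ (g.around u).image κ :=
            (g.shatter u κ).mem_of_adj hab.symm
          rw [Finset.mem_union] at hb'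
          rcases hb' with hb' | hb'
          · exact hb (Finset.mem_of_mem_erase hb')
          · obtain ⟨z, hz, rfl⟩ := Finset.mem_image.1 hb'
            exact hua ((h.shatter_adj_copy hz).1 hab.symm).1.reachable
      · exact fun a ha hua =>
          Finset.mem_union_left _ (Finset.mem_erase.2 ⟨fun hau => hua (hau ▸ .rfl), ha⟩)
      · exact fun a ha _ => h.reach_of_mem_used (g.verts_subset ha)
  · rw [weightedScore_of_notMem _ hxv, weightedScore_of_notMem]
    intro hx'
    rcases Finset.mem_union.1 hx' with hx' | hx'
    · exact hxv (Finset.mem_of_mem_erase hx')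
    · obtain ⟨z, hz, rfl⟩ := Finset.mem_image.1 hx'
      exact h.fresh z hz hx

/-- The removed u keeps its compensation while its score drops to 0. The local copies, having the
same original, take over that score and start without compensation because they are fresh. -/
theorem LocalCopies.total_shatter (hbc : ∀ x ∉ g.used, g.bc x = 0) (v : V) :
    (g.shatter u κ).total v = g.total v := by
  have hdisj : Disjoint g.used ((g.around u).image κ) := by
    rw [Finset.disjoint_right]
    intro y hy
    obtain ⟨z, hz, rfl⟩ := Finset.mem_image.1 hy
    exact h.fresh z hz
  have huv' : u ∉ (g.shatter u κ).verts := by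
    intro hu'
    rcases Finset.mem_union.1 hu' with hu' | hu'
    · simp at hu'
    · exact Finset.disjoint_left.1 hdisj (g.verts_subset hu) hu'
  have hused : (g.shatter u κ).used = g.used ∪ (g.around u).image κ := rfl
  have hb : (g.shatter u κ).bc = g.bc := rfl
  rw [total, total, hused, Finset.filter_union,
    Finset.sum_union (Finset.disjoint_filter_filter hdisj), hb]
  have horg : ∀ y ∈ (g.around u).image κ, org y = org u := by
    intro y hy
    obtain ⟨z, hz, rfl⟩ := Finset.mem_image.1 hy
    exact h.org_eq z hz
  by_cases huv : org u = v
  · have hmem : u ∈ g.used.filter (fun x => org x = v) :=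
      Finset.mem_filter.2 ⟨g.verts_subset hu, huv⟩
    have hfil : (((g.around u).image κ).filter fun x => org x = v) = (g.around u).image κ :=
      Finset.filter_true_of_mem fun y hy => (horg y hy).trans huv
    have h1 : ∀ y ∈ (g.around u).image κ, g.bc y + (g.shatter u κ).weightedScore y =
        (g.shatter u κ).weightedScore y := fun y hy => by
      rw [hbc y (Finset.disjoint_right.1 hdisj hy), zero_add]
    rw [hfil, Finset.sum_congr rfl h1, h.sum_weightedScore hu, ← Finset.add_sum_erase _ _ hmem,
      ← Finset.add_sum_erase (f := fun x => g.bc x + g.weightedScore x) _ hmem,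
      weightedScore_of_notMem _ huv', Finset.sum_congr rfl (g := fun x => g.bc x + g.weightedScore x)]
    · ring
    · intro x hx
      rw [Finset.mem_erase, Finset.mem_filter] at hx
      rw [h.weightedScore_of_mem_used hu hx.2.1 hx.1]
  · have hfil : (((g.around u).image κ).filter fun x => org x = v) = ∅ :=
      Finset.filter_false_of_mem fun y hy hyv => huv ((horg y hy).symm.trans hyv)
    rw [hfil, Finset.sum_empty, add_zero]
    refine Finset.sum_congr rfl fun x hx => ?_
    rw [Finset.mem_filter] at hx
    rw [h.weightedScore_of_mem_used hu hx.1 (fun hxu => huv (hxu ▸ hx.2))]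

end Shatter

/-! ### The initial state and the conclusion -/

theorem total_initial [Fintype V] (G : SimpleGraph V) (v : V) :
    (initial G).total v = score G Finset.univ (fun _ => 1) v := by
  classical
  have hfil : (initial G).used.filter (fun x => org x = v) = {(v, 0)} := by
    ext ⟨w, i⟩
    simp only [initial, org, Prod.mk.injEq, Finset.mem_singleton]
    grind
  have hinj : Function.Injective fun v : V => ((v, 0) : Copy V) := fun a b hab =>
    (Prod.mk.inj hab).1
  have hadj : ∀ a b : V, (initial G).G.Adj (a, 0) (b, 0) ↔ G.Adj a b := by
    intro a b
    simp only [initial, SimpleGraph.map_adj']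
    constructor
    · rintro ⟨-, a', b', hab, ha, hb⟩
      rwa [← (Prod.mk.inj ha).1, ← (Prod.mk.inj hb).1]
    · exact fun hab => ⟨fun he => hab.ne (Prod.mk.inj he).1, a, b, hab, rfl, rfl⟩
  set A : Finset V := Finset.univ.filter fun x => G.Reachable v x with hA
  have hmem : ∀ x, x ∈ A ↔ G.Reachable v x := fun x => by simp [hA]
  have hW : ∀ ⦃x y⦄, G.Adj x y → x ∈ Finset.univ := fun _ _ _ => Finset.mem_univ _
  have hs : IsComponentSplit G Finset.univ A ∅ :=
    .of_reachable hW (Finset.mem_univ v) (Finset.disjoint_empty_right _)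
      (by simpa only [Finset.union_empty] using hmem)
  have hclosed : ∀ a ∈ A, ∀ b, G.Adj a b → b ∈ A := fun a ha b hab =>
    (hmem b).2 (((hmem a).1 ha).trans hab.reachable)
  have hiso : IsComponentIso G A (initial G).G (initial G).verts fun v => (v, 0) :=
    { injOn := hinj.injOn
      adj_iff := fun a _ b _ => hadj a b
      closed := geodesicallyClosed_of_adj hclosed
      reachable := fun a ha b hb => ((hmem a).1 ha).symm.trans ((hmem b).1 hb)
      exists_of_adj := fun a ha y hy => by
        obtain ⟨b, -, rfl⟩ := Finset.mem_image.1 ((initial G).mem_of_adj hy.symm)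
        exact ⟨b, hclosed a ha b ((hadj a b).1 hy), rfl⟩
      mem := fun a _ => Finset.mem_image_of_mem _ (Finset.mem_univ a) }
  have h1 := hiso.score_eq_of_isComponent (r := fun _ => 1)
    (r' := fun x => ((initial G).reach x : ℚ)) hs hW (initial G).mem_verts_of_adj
    (fun a _ => by simp [initial]) ((hmem v).2 .rfl)
  rw [total, hfil, Finset.sum_singleton, weightedScore, h1]
  simp [initial]

end State

variable {V : Type*} [DecidableEq V]

/-- Every operation preserves the total score of the copies of each vertex. -/
theorem Step.total_eq {g g' : State V} (h : Step g g') (hbc : ∀ x ∉ g.used, g.bc x = 0) (v : V) :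
    g'.total v = g.total v := by
  cases h with
  | articulation u κ hu hκ => exact hκ.total_shatter hu.1 hbc v
  | bridge u v' h => exact g.total_eq_of_forall (g.removeBridge u v') rfl h.removeBridge_eq v
  | degreeOne u v' h => exact g.total_eq_of_forall (g.removeDegreeOne u v') rfl h.removeDegreeOne_eq v
  | side L u hu => exact g.total_eq_of_forall (g.removeSide L u) rfl (hu.removeSide_eq L) v

/-- This is needed when shattering brings new copies into the sum. For the other operations it
follows from the pointwise identity, since a copy that was never used has score 0 before and after.
-/
theorem Step.bc_eq_zero {g g' : State V} (h : Step g g') (hbc : ∀ x ∉ g.used, g.bc x = 0) :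
    ∀ x ∉ g'.used, g'.bc x = 0 := by
  have key : ∀ g' : State V, g'.used = g.used →
      (∀ x, g'.bc x + g'.weightedScore x = g.bc x + g.weightedScore x) →
      ∀ x ∉ g'.used, g'.bc x = 0 := by
    intro g' hused heq x hx
    have h1 := heq x
    rw [State.weightedScore_of_notMem _ fun hx' => hx (g'.verts_subset hx'),
      State.weightedScore_of_notMem _ fun hx' => hx (hused ▸ g.verts_subset hx'),
      hbc x (hused ▸ hx)] at h1
    simpa using h1
  cases h with
  | articulation u κ hu hκ => exact fun x hx => hbc x fun hx' => hx (Finset.mem_union_left _ hx')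
  | bridge u v' h => exact key _ rfl h.removeBridge_eq
  | degreeOne u v' h => exact key _ rfl h.removeDegreeOne_eq
  | side L u hu => exact key _ rfl (hu.removeSide_eq L)

theorem Preprocessed.total_eq [Fintype V] {G : SimpleGraph V} {g : State V}
    (h : Preprocessed G g) (v : V) : g.total v = betweenness G v := by
  rw [betweenness_eq_score, ← State.total_initial]
  suffices (∀ x ∉ g.used, g.bc x = 0) ∧ g.total v = (State.initial G).total v from this.2
  induction h with
  | refl => exact ⟨fun _ _ => rfl, rfl⟩
  | tail _ hstep ih => exact ⟨hstep.bc_eq_zero ih.1, (hstep.total_eq ih.1 v).trans ih.2⟩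

theorem finalScore_eq (g : State V) (L : Listing g.verts g.G) (x : Copy V) :
    finalScore g L x = g.bc x + g.weightedScore x := by
  rw [finalScore, bcReach_eq_score g.mem_verts_of_adj L, State.weightedScore]

end BC

theorem mainTheorem4 {V : Type*} [Fintype V] [DecidableEq V] (G : SimpleGraph V)
    (L : BC.Listing Finset.univ G)
    (g : BC.State V) (hg : BC.Preprocessed G g) (L' : BC.Listing g.verts g.G) (v : V) :
    BC.bcOrg L v = ∑ x ∈ g.used with BC.org x = v, BC.finalScore g L' x ∧
      BC.betweenness G v = ∑ x ∈ g.used with BC.org x = v, BC.finalScore g L' x := by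
  have h : BC.betweenness G v = ∑ x ∈ g.used with BC.org x = v, BC.finalScore g L' x := by
    rw [← hg.total_eq v, BC.State.total]
    exact Finset.sum_congr rfl fun x _ => (BC.finalScore_eq g L' x).symm
  refine ⟨?_, h⟩
  rw [← h, BC.betweenness_eq_score, BC.bcOrg_eq_score fun _ _ _ => Finset.mem_univ _]
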